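/- **Theorem (State Machine Safety).** Consider $n$ servers with ids $0,\dots,n-1$ running either the Paxos algorithm or the Raft algorithm described below. In every execution: if a server applies a log entry $e$ at index $i$ to its state machine and a server applies a log entry $e'$ at the same index $i$ to its state machine (at any times), then, for Paxos, $e$ and $e'$ carry the same operation and, for Raft, $e=e'$ (same operation and same term). *Setting.* The system is asynchronous and non-Byzantine; a message that was sent may be delivered after any delay (reordering, repetition and loss are also allowed). A log entry is a pair of an operation and a term; a log is a finite sequence of entries with first index $1$. A majority is a set of more than $n/2$ servers. Each server stores persistently a term `currentTerm` (initially $0$) and a log (initially empty), in Raft also `votedFor` (initially null), and as volatile state its role (initially follower), `commitIndex` and `lastApplied` (initially $0$), the votes received if it is a candidate (in Paxos also a collection `entries[]` of indexed log entries), and numbers `nextIndex[j]`, `matchIndex[j]` for each server $j$ if it is a leader. A server may crash and restart at any time, losing its volatile state. A reply can be associated with its request. *Rules common to both.* A server that sees a message with a term $T>$ `currentTerm` sets `currentTerm` $=T$ (and in Raft `votedFor` to null) and becomes a follower. Requests with a smaller term than `currentTerm` are answered negatively; every reply contains the replier's current term, and replies to requests of an earlier term than the receiver's have no other effect. If `commitIndex`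 $>$ `lastApplied`, a server may increment `lastApplied` and apply the log entry at that index to its state machine. A leader may append any operation with its current term to its log. A leader may send to any other server $j$ an AppendEntries request with its term, its `commitIndex`, `prevLogIndex` $=$ `nextIndex[j]` $-1$, the term of its entry there, and entries of its log starting at index `nextIndex[j]`: in Paxos all of them or none (heartbeat), in Raft any number of them. The receiver (in Raft, after becoming a follower) answers negatively if `prevLogIndex` $>0$ and its log has no entry at `prevLogIndex` with the given term; otherwise, if an existing entry conflicts with a new one (same index, different terms), it deletes that entry and all that follow it, appends the new entries it does not have, raises its `commitIndex` to the minimum of the leader's `commitIndex` and the index $\ell=$ `prevLogIndex` $+$ (number of entries sent) if that is larger, and answers positively. On a positive answer from $j$ a leader sets `nextIndex[j]` $=\ell+1$ and raises `matchIndex[j]` to at least $\ell$; on a negative one (in its term) it decrements `nextIndex[j]` if that exceeds $1$. *Paxos.* A follower $s$ may at any time become a candidate: it sets its term to the least $t>$ `currentTerm` with $t \bmod n=s$, votes for itself, puts its log entries after `commitIndex` in `entries[]`, and sends RequestVote with $t$ and its `commitIndex` $c$ to all others. A server whose term is at most $t$ grants the vote and sends its log entries after $c$, which the candidate adds to `entries[]`.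 With votes from a majority, the candidate keeps its log up to $c$, fills each later index for which `entries[]` has an entry with the operation of an entry of greatest term for that index, together with its current term, and becomes leader with all `nextIndex[j]` $=c+1$ and `matchIndex[j]` $=0$. A leader may set `commitIndex` $=N$ if $N>$ `commitIndex`, its log has length at least $N$, and it together with the servers $j$ with `matchIndex[j]` $\ge N$ forms a majority. *Raft.* A follower or candidate may at any time increment its term, become a candidate, vote for itself, and send RequestVote with its term and the index and term of its last log entry to all others. A server whose term is at most the candidate's grants the vote if, in this term, it has voted for nobody or for this candidate, and the candidate's last log term is greater than its own or is equal to it and the candidate's last log index is at least its own. With votes from a majority, the candidate becomes leader with all `nextIndex[j]` equal to its last log index plus $1$ and `matchIndex[j]` $=0$. A leader may set `commitIndex` $=N$ under the same conditions as in Paxos if moreover its entry at index $N$ has its current term. -/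

import Mathlib

namespace Consensus

/-! ### Log entries, logs and remote procedure calls common to both algorithms -/

/-- A log entry: an operation of the state machine together with a term. -/
structure Entry (Op : Type*) where
  op : Op
  term : ℕ

inductive Role where
  | follower
  | candidate
  | leader
  deriving DecidableEq

/-- The entry of a log at a given index; the first index is `1`. -/
def entryAt {Op : Type*} (log : List (Entry Op)) (i : ℕ) : Option (Entry Op) :=
  if i = 0 then none else log[i - 1]?

/-- The term of the entry at index `i` (`0` if there is none, in particular at index `0`). -/
def termAt {Op : Type*} (log : List (Entry Op)) (i : ℕ) : ℕ :=
  ((entryAt log i).map Entry.term).getD 0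

/-- The log contains an entry at index `i` whose term is `t`; the empty prefix (`i = 0`) always
matches. -/
def Matches {Op : Type*} (log : List (Entry Op)) (i t : ℕ) : Prop :=
  i = 0 ∨ (entryAt log i).map Entry.term = some t

instance {Op : Type*} (log : List (Entry Op)) (i t : ℕ) : Decidable (Matches log i t) :=
  inferInstanceAs (Decidable (_ ∨ _))

/-- Overwrite the existing entries (first argument) by the new ones (second argument), where both
lists start at the same index: at the first index where the terms conflict, the existing entry and
all that follow it are deleted; new entries not already present are appended. -/
def overwrite {Op : Type*} : List (Entry Op) → List (Entry Op) → List (Entry Op)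
  | old, [] => old
  | [], new => new
  | o :: old, e :: new => if o.term = e.term then o :: overwrite old new else e :: new

/-- Store `entries` in the log directly after index `prev`. -/
def store {Op : Type*} (log : List (Entry Op)) (prev : ℕ) (entries : List (Entry Op)) :
    List (Entry Op) :=
  log.take prev ++ overwrite (log.drop prev) entries

/-- Strictly more than half of the `n` servers. -/
def IsMajority {n : ℕ} (Q : Finset (Fin n)) : Prop := n < 2 * Q.card

/-- Arguments of the AppendEntries RPC. -/
structure AppendArgs (Op : Type*) where
  term : ℕ
  prevLogIndex : ℕ
  prevLogTerm : ℕ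
  entries : List (Entry Op)
  leaderCommit : ℕ

/-- The index of the last log entry covered by an AppendEntries request. -/
def AppendArgs.lastIndex {Op : Type*} (a : AppendArgs Op) : ℕ :=
  a.prevLogIndex + a.entries.length

structure Message (n : ℕ) (Payload : Type*) where
  src : Fin n
  dst : Fin n
  payload : Payload

/-! ### Asynchronous message-passing systems

A protocol is run by `n` servers with ids `0, …, n - 1`. All steps of all servers are interleaved
arbitrarily. A message that has been sent may be delivered at any later time. The network keeps it
for ever, so that messages may be delayed, reordered, repeated, or never delivered: in particular
the executions in which the channels are reliable and in-order are among those considered. -/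

structure Protocol (n : ℕ) (Op Server Payload : Type*) where
  /-- The state of every server on first boot. -/
  init : Server
  /-- `act s x ev x' out`: server `s` may on its own go from state `x` to state `x'`, sending the
  messages `out`; if `ev = some (i, e)`, then it thereby applies the log entry `e` at index `i` to
  its state machine. -/
  act : Fin n → Server → Option (ℕ × Entry Op) → Server → Set (Message n Payload) → Prop
  /-- The new state of server `s` and the messages it sends when it receives a message. -/
  receive : Fin n → Server → Message n Payload → Server × Set (Message n Payload)

/-- A global state: the states of all the servers and all messages sent so far. -/
structure Global (n : ℕ) (Server Payload : Type*) where
  server : Fin n → Server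
  net : Set (Message n Payload)

/-- The event that `server` applies the log entry `entry` at index `index` to its state machine. -/
structure Applied (n : ℕ) (Op : Type*) where
  server : Fin n
  index : ℕ
  entry : Entry Op

variable {n : ℕ} {Op Server Payload : Type*}

inductive Step (P : Protocol n Op Server Payload) :
    Global n Server Payload → Option (Applied n Op) → Global n Server Payload → Prop
  | act (σ : Global n Server Payload) (s : Fin n) (ev : Option (ℕ × Entry Op)) (x' : Server)
      (out : Set (Message n Payload)) (h : P.act s (σ.server s) ev x' out) :
      Step P σ (ev.map fun p => ⟨s, p.1, p.2⟩)
        ⟨Function.update σ.server s x', σ.net ∪ out⟩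
  | deliver (σ : Global n Server Payload) (m : Message n Payload) (hm : m ∈ σ.net) :
      Step P σ none
        ⟨Function.update σ.server m.dst (P.receive m.dst (σ.server m.dst) m).1,
          σ.net ∪ (P.receive m.dst (σ.server m.dst) m).2⟩

/-- `Run P h σ`: some finite execution of `P` from the initial state ends in `σ`, and `h` lists, in
chronological order, all the applications of log entries to state machines that occur in it. -/
inductive Run (P : Protocol n Op Server Payload) :
    List (Applied n Op) → Global n Server Payload → Prop
  | init : Run P [] ⟨fun _ => P.init, ∅⟩
  | step (h : List (Applied n Op)) (σ : Global n Server Payload) (ev : Option (Applied n Op))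
      (σ' : Global n Server Payload) (hrun : Run P h σ) (hstep : Step P σ ev σ') :
      Run P (h ++ ev.toList) σ'

end Consensus

/-! ### Paxos -/

namespace Consensus.Paxos

structure Server (n : ℕ) (Op : Type*) where
  /- persistent state -/
  currentTerm : ℕ
  log : List (Entry Op)
  /- volatile state on all servers -/
  role : Role
  commitIndex : ℕ
  lastApplied : ℕ
  /- volatile state on candidates: who has voted, and the log entries received with the votes,
  each with its index -/
  votes : Finset (Fin n)
  entries : Set (ℕ × Entry Op)
  /- volatile state on leaders -/
  nextIndex : Fin n → ℕ
  matchIndex : Fin n → ℕ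

/-- The messages. A reply to an RPC is accompanied by the arguments of the request that it
answers. -/
inductive Payload (Op : Type*) where
  | requestVote (term leaderCommit : ℕ)
  | voteReply (reqTerm reqLeaderCommit : ℕ) (term : ℕ) (voteGranted : Bool)
      (entries : List (Entry Op))
  | appendEntries (args : AppendArgs Op)
  | appendReply (req : AppendArgs Op) (term : ℕ) (success : Bool)

variable {n : ℕ} {Op : Type*}

/-- A server with the given persistent state and reset volatile state. -/
def boot (currentTerm : ℕ) (log : List (Entry Op)) : Server n Op where
  currentTerm := currentTerm
  log := log
  role := .follower
  commitIndex := 0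
  lastApplied := 0
  votes := ∅
  entries := ∅
  nextIndex := fun _ => 1
  matchIndex := fun _ => 0

/-- The list `l` of log entries with their indices, the first index being `c + 1`. -/
def indexed (c : ℕ) (l : List (Entry Op)) : Set (ℕ × Entry Op) :=
  {p | ∃ k, l[k]? = some p.2 ∧ p.1 = c + k + 1}

/-- `log'` results from `log` by keeping the entries up to the commit index `c` and filling each
index after `c` for which `entries` has an entry with the operation of an entry of greatest term for
that index and the new term `t`. -/
def Adopts (t c : ℕ) (log : List (Entry Op)) (entries : Set (ℕ × Entry Op))
    (log' : List (Entry Op)) : Prop :=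
  (∀ i ≤ c, entryAt log' i = entryAt log i) ∧
  ∀ i, c < i →
    ((∀ e, (i, e) ∉ entries) ∧ entryAt log' i = none) ∨
    ∃ e, (i, e) ∈ entries ∧ (∀ e₂, (i, e₂) ∈ entries → e₂.term ≤ e.term) ∧
      entryAt log' i = some ⟨e.op, t⟩

/-- An RPC request or response with term `t` has been seen: a greater term is adopted, and the
server converts to follower. -/
def Server.observe (x : Server n Op) (t : ℕ) : Server n Op :=
  if x.currentTerm < t then { x with currentTerm := t, role := .follower } else x

/-- The AppendEntries request of leader `x` for server `j` with the given entries, which are to be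
stored starting at `nextIndex` for `j`. -/
def Server.appendArgs (x : Server n Op) (j : Fin n) (entries : List (Entry Op)) :
    AppendArgs Op where
  term := x.currentTerm
  prevLogIndex := x.nextIndex j - 1
  prevLogTerm := termAt x.log (x.nextIndex j - 1)
  entries := entries
  leaderCommit := x.commitIndex

/-- The steps that a server takes on its own. -/
inductive Act (s : Fin n) : Server n Op → Option (ℕ × Entry Op) → Server n Op →
    Set (Message n (Payload Op)) → Prop
  /-- Crash and restart: only the persistent state survives. -/
  | restart (x : Server n Op) : Act s x none (boot x.currentTerm x.log) ∅
  /-- Election timeout: the follower `s` becomes a candidate in the next term congruent to `s`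
  modulo `n`. -/
  | timeout (x : Server n Op) (t : ℕ) (hrole : x.role = .follower)
      (ht : IsLeast {t : ℕ | x.currentTerm < t ∧ t % n = s} t) :
      Act s x none
        { x with
          currentTerm := t
          role := .candidate
          votes := {s}
          entries := indexed x.commitIndex (x.log.drop x.commitIndex) }
        {m | ∃ j, j ≠ s ∧ m = ⟨s, j, .requestVote t x.commitIndex⟩}
  | becomeLeader (x : Server n Op) (log' : List (Entry Op)) (hrole : x.role = .candidate)
      (hvotes : IsMajority x.votes)
      (hlog : Adopts x.currentTerm x.commitIndex x.log x.entries log') :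
      Act s x none
        { x with
          log := log'
          role := .leader
          votes := ∅
          entries := ∅
          nextIndex := fun _ => x.commitIndex + 1
          matchIndex := fun _ => 0 }
        ∅
  /-- The leader receives the operation `op` from a client. -/
  | clientRequest (x : Server n Op) (op : Op) (hrole : x.role = .leader) :
      Act s x none { x with log := x.log ++ [⟨op, x.currentTerm⟩] } ∅
  /-- The leader sends its log entries starting at `nextIndex` to `j`. -/
  | replicate (x : Server n Op) (j : Fin n) (hj : j ≠ s) (hrole : x.role = .leader)
      (hnext : x.nextIndex j ≤ x.log.length) :
      Act s x none x
        {⟨s, j, .appendEntries (x.appendArgs j (x.log.drop (x.nextIndex j - 1)))⟩}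
  | heartbeat (x : Server n Op) (j : Fin n) (hj : j ≠ s) (hrole : x.role = .leader) :
      Act s x none x {⟨s, j, .appendEntries (x.appendArgs j [])⟩}
  /-- The leader, whose own log reaches up to index `N`, knows that a majority of the servers
  (itself included) stores its log up to index `N`. -/
  | advanceCommit (x : Server n Op) (N : ℕ) (hrole : x.role = .leader)
      (hN : x.commitIndex < N) (hlen : N ≤ x.log.length)
      (hmaj : IsMajority (Finset.univ.filter fun j => j = s ∨ N ≤ x.matchIndex j)) :
      Act s x none { x with commitIndex := N } ∅
  | apply (x : Server n Op) (e : Entry Op) (hlt : x.lastApplied < x.commitIndex)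
      (he : entryAt x.log (x.lastApplied + 1) = some e) :
      Act s x (some (x.lastApplied + 1, e)) { x with lastApplied := x.lastApplied + 1 } ∅

/-- The reaction of server `s` in state `x` to a message. -/
def receive (s : Fin n) (x : Server n Op) (m : Message n (Payload Op)) :
    Server n Op × Set (Message n (Payload Op)) :=
  match m.payload with
  | .requestVote t c =>
    if t < x.currentTerm then
      (x, {⟨s, m.src, .voteReply t c x.currentTerm false []⟩})
    else
      (x.observe t, {⟨s, m.src, .voteReply t c t true (x.log.drop c)⟩})
  | .voteReply reqTerm c t granted entries =>
    let y := x.observe t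
    if y.role = .candidate ∧ reqTerm = y.currentTerm ∧ t = y.currentTerm ∧ granted = true then
      ({ y with
          votes := insert m.src y.votes
          entries := y.entries ∪ indexed c entries }, ∅)
    else (y, ∅)
  | .appendEntries a =>
    if a.term < x.currentTerm then
      (x, {⟨s, m.src, .appendReply a x.currentTerm false⟩})
    else
      let y := x.observe a.term
      if Matches y.log a.prevLogIndex a.prevLogTerm then
        ({ y with
            log := store y.log a.prevLogIndex a.entries
            commitIndex := max y.commitIndex (min a.leaderCommit a.lastIndex) },
          {⟨s, m.src, .appendReply a y.currentTerm true⟩})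
      else (y, {⟨s, m.src, .appendReply a y.currentTerm false⟩})
  | .appendReply a t success =>
    let y := x.observe t
    if y.role = .leader ∧ a.term = y.currentTerm ∧ t = y.currentTerm then
      if success = true then
        ({ y with
            nextIndex := Function.update y.nextIndex m.src (a.lastIndex + 1)
            matchIndex :=
              Function.update y.matchIndex m.src (max (y.matchIndex m.src) a.lastIndex) }, ∅)
      else
        ({ y with
            nextIndex := Function.update y.nextIndex m.src (max 1 (y.nextIndex m.src - 1)) }, ∅)
    else (y, ∅)

/-- The Paxos algorithm on `n` servers. -/
def protocol (n : ℕ) (Op : Type*) : Protocol n Op (Server n Op) (Payload Op) where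
  init := boot 0 []
  act := Act
  receive := receive

end Consensus.Paxos

/-! ### Raft -/

namespace Consensus.Raft

structure Server (n : ℕ) (Op : Type*) where
  /- persistent state -/
  currentTerm : ℕ
  votedFor : Option (Fin n)
  log : List (Entry Op)
  /- volatile state on all servers -/
  role : Role
  commitIndex : ℕ
  lastApplied : ℕ
  /- volatile state on candidates -/
  votes : Finset (Fin n)
  /- volatile state on leaders -/
  nextIndex : Fin n → ℕ
  matchIndex : Fin n → ℕ

/-- The messages. A reply to an RPC is accompanied by the arguments of the request that it
answers. The candidate id of a RequestVote request is the source of the message. -/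
inductive Payload (Op : Type*) where
  | requestVote (term lastLogIndex lastLogTerm : ℕ)
  | voteReply (reqTerm : ℕ) (term : ℕ) (voteGranted : Bool)
  | appendEntries (args : AppendArgs Op)
  | appendReply (req : AppendArgs Op) (term : ℕ) (success : Bool)

variable {n : ℕ} {Op : Type*}

/-- A server with the given persistent state and reset volatile state. -/
def boot (currentTerm : ℕ) (votedFor : Option (Fin n)) (log : List (Entry Op)) :
    Server n Op where
  currentTerm := currentTerm
  votedFor := votedFor
  log := log
  role := .follower
  commitIndex := 0
  lastApplied := 0
  votes := ∅
  nextIndex := fun _ => 1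
  matchIndex := fun _ => 0

/-- A log with the given last index and last term is at least as up-to-date as `log`. -/
def UpToDate (lastIndex lastTerm : ℕ) (log : List (Entry Op)) : Prop :=
  termAt log log.length < lastTerm ∨
    (termAt log log.length = lastTerm ∧ log.length ≤ lastIndex)

instance (lastIndex lastTerm : ℕ) (log : List (Entry Op)) :
    Decidable (UpToDate lastIndex lastTerm log) :=
  inferInstanceAs (Decidable (_ ∨ _))

/-- An RPC request or response with term `t` has been seen: a greater term, in which the server has
not voted yet, is adopted, and the server converts to follower. -/
def Server.observe (x : Server n Op) (t : ℕ) : Server n Op :=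
  if x.currentTerm < t then
    { x with currentTerm := t, votedFor := none, role := .follower }
  else x

/-- The AppendEntries request of leader `x` for server `j` with the given entries, which are to be
stored starting at `nextIndex` for `j`. -/
def Server.appendArgs (x : Server n Op) (j : Fin n) (entries : List (Entry Op)) :
    AppendArgs Op where
  term := x.currentTerm
  prevLogIndex := x.nextIndex j - 1
  prevLogTerm := termAt x.log (x.nextIndex j - 1)
  entries := entries
  leaderCommit := x.commitIndex

/-- The steps that a server takes on its own. -/
inductive Act (s : Fin n) : Server n Op → Option (ℕ × Entry Op) → Server n Op →
    Set (Message n (Payload Op)) → Prop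
  /-- Crash and restart: only the persistent state survives. -/
  | restart (x : Server n Op) : Act s x none (boot x.currentTerm x.votedFor x.log) ∅
  /-- Election timeout of a follower or a candidate. -/
  | timeout (x : Server n Op) (hrole : x.role ≠ .leader) :
      Act s x none
        { x with
          currentTerm := x.currentTerm + 1
          votedFor := some s
          role := .candidate
          votes := {s} }
        {m | ∃ j, j ≠ s ∧
          m = ⟨s, j, .requestVote (x.currentTerm + 1) x.log.length
            (termAt x.log x.log.length)⟩}
  | becomeLeader (x : Server n Op) (hrole : x.role = .candidate) (hvotes : IsMajority x.votes) :
      Act s x none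
        { x with
          role := .leader
          votes := ∅
          nextIndex := fun _ => x.log.length + 1
          matchIndex := fun _ => 0 }
        ∅
  /-- The leader receives the operation `op` from a client. -/
  | clientRequest (x : Server n Op) (op : Op) (hrole : x.role = .leader) :
      Act s x none { x with log := x.log ++ [⟨op, x.currentTerm⟩] } ∅
  /-- The leader sends `k` of its log entries (or all, if there are fewer), starting at
  `nextIndex`, to `j`; for `k = 0` this is a heartbeat. -/
  | replicate (x : Server n Op) (j : Fin n) (k : ℕ) (hj : j ≠ s) (hrole : x.role = .leader) :
      Act s x none x
        {⟨s, j, .appendEntries (x.appendArgs j ((x.log.drop (x.nextIndex j - 1)).take k))⟩}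
  /-- The leader, whose own log has an entry of its current term at index `N`, knows that a majority
  of the servers (itself included) stores its log up to index `N`. -/
  | advanceCommit (x : Server n Op) (N : ℕ) (e : Entry Op) (hrole : x.role = .leader)
      (hN : x.commitIndex < N) (he : entryAt x.log N = some e) (hterm : e.term = x.currentTerm)
      (hmaj : IsMajority (Finset.univ.filter fun j => j = s ∨ N ≤ x.matchIndex j)) :
      Act s x none { x with commitIndex := N } ∅
  | apply (x : Server n Op) (e : Entry Op) (hlt : x.lastApplied < x.commitIndex)
      (he : entryAt x.log (x.lastApplied + 1) = some e) :
      Act s x (some (x.lastApplied + 1, e)) { x with lastApplied := x.lastApplied + 1 } ∅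

/-- The reaction of server `s` in state `x` to a message. -/
def receive (s : Fin n) (x : Server n Op) (m : Message n (Payload Op)) :
    Server n Op × Set (Message n (Payload Op)) :=
  match m.payload with
  | .requestVote t lastIndex lastTerm =>
    if t < x.currentTerm then
      (x, {⟨s, m.src, .voteReply t x.currentTerm false⟩})
    else
      let y := x.observe t
      if (y.votedFor = none ∨ y.votedFor = some m.src) ∧ UpToDate lastIndex lastTerm y.log then
        ({ y with votedFor := some m.src }, {⟨s, m.src, .voteReply t y.currentTerm true⟩})
      else (y, {⟨s, m.src, .voteReply t y.currentTerm false⟩})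
  | .voteReply reqTerm t granted =>
    let y := x.observe t
    if y.role = .candidate ∧ reqTerm = y.currentTerm ∧ t = y.currentTerm ∧ granted = true then
      ({ y with votes := insert m.src y.votes }, ∅)
    else (y, ∅)
  | .appendEntries a =>
    if a.term < x.currentTerm then
      (x, {⟨s, m.src, .appendReply a x.currentTerm false⟩})
    else
      let y := { x.observe a.term with role := .follower }
      if Matches y.log a.prevLogIndex a.prevLogTerm then
        ({ y with
            log := store y.log a.prevLogIndex a.entries
            commitIndex := max y.commitIndex (min a.leaderCommit a.lastIndex) },
          {⟨s, m.src, .appendReply a y.currentTerm true⟩})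
      else (y, {⟨s, m.src, .appendReply a y.currentTerm false⟩})
  | .appendReply a t success =>
    let y := x.observe t
    if y.role = .leader ∧ a.term = y.currentTerm ∧ t = y.currentTerm then
      if success = true then
        ({ y with
            nextIndex := Function.update y.nextIndex m.src (a.lastIndex + 1)
            matchIndex :=
              Function.update y.matchIndex m.src (max (y.matchIndex m.src) a.lastIndex) }, ∅)
      else
        ({ y with
            nextIndex := Function.update y.nextIndex m.src (max 1 (y.nextIndex m.src - 1)) }, ∅)
    else (y, ∅)

/-- The Raft algorithm on `n` servers. -/
def protocol (n : ℕ) (Op : Type*) : Protocol n Op (Server n Op) (Payload Op) where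
  init := boot 0 none []
  act := Act
  receive := receive

end Consensus.Raft

namespace Consensus

variable {n : ℕ} {Op : Type*}

/-! ### Logs -/

/-! Both proofs attach to each execution a history (`View`) that the servers themselves forget: the
log of the leader of each term, the set of elected terms, and, for each server and term, the length
of the initial segment of that leader's log that the server acknowledged. An index is `Chosen` in
term `t` if a majority acknowledged it in that term. Safety compares chosen indices across terms,
but an index may become chosen only after a later leader has been elected. The invariants therefore
speak of `Choosable` indices, where the servers that have not yet left term `t` are counted as well.
Acknowledgements for a term are frozen once a server has moved past it, so along an execution
`Choosable` can only be lost and `Chosen` can only be gained. When a leader of term `t` is elected,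
a majority has reached term `t`. It meets every majority that witnesses choosability in a term `u <
t`, and a common server must have acknowledged the index already. This server's vote carries the
information to the new leader.

In Paxos the argument is made index by index, since an election rewrites terms. A choosable proposal
determines the operation of all later proposals at its index. A server that acknowledged it holds
there an entry whose term is at least as large, or one that is `Settled`: the index was chosen no
later than in that entry's own term. Hence the reported entry of greatest term has the right
operation (`Paxos.LogInv.elect`). Deletions do no harm, because a request that is not a heartbeat
contains the whole rest of the leader's log. Terms have unique leaders by their residue modulo `n`.

In Raft the argument concerns initial segments. If an entry created in term `u` is choosable in that
term, then the segment ending there is a prefix of the log of every later leader: the voting rule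
and the monotonicity of terms along a log force the candidate to possess it (`Raft.LogInv.fresh`,
`Raft.LogInv.elect`). Terms have unique leaders because two majorities of votes intersect.

Both cases rest on log matching (`View.Genuine.take_eq`): an entry's index and term determine the
log up to it. It turns the storage of a request into the operation `merge`. It then remains to check
that each step of one server preserves the invariant (`Local.act`, `Local.receive`, `Inv.step`). -/

theorem entryAt_eq_some {l : List (Entry Op)} {i : ℕ} {e : Entry Op} :
    entryAt l i = some e ↔ 0 < i ∧ l[i - 1]? = some e := by
  unfold entryAt
  split_ifs with h
  · simp [h]
  · simp [Nat.pos_of_ne_zero h]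

theorem entryAt_pos {l : List (Entry Op)} {i : ℕ} {e : Entry Op} (h : entryAt l i = some e) :
    0 < i :=
  (entryAt_eq_some.1 h).1

theorem entryAt_le_length {l : List (Entry Op)} {i : ℕ} {e : Entry Op}
    (h : entryAt l i = some e) : i ≤ l.length := by
  obtain ⟨h0, h1⟩ := entryAt_eq_some.1 h
  obtain ⟨h2, -⟩ := List.getElem?_eq_some_iff.1 h1
  omega

theorem exists_entryAt {l : List (Entry Op)} {i : ℕ} (h0 : 0 < i) (h : i ≤ l.length) :
    ∃ e, entryAt l i = some e :=
  ⟨l[i - 1], entryAt_eq_some.2 ⟨h0, List.getElem?_eq_getElem (by omega)⟩⟩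

theorem entryAt_of_prefix {l l' : List (Entry Op)} {i : ℕ} {e : Entry Op} (hp : l <+: l')
    (h : entryAt l i = some e) : entryAt l' i = some e := by
  rw [entryAt_eq_some] at h ⊢
  obtain ⟨t, rfl⟩ := hp
  obtain ⟨h2, -⟩ := List.getElem?_eq_some_iff.1 h.2
  exact ⟨h.1, by rw [List.getElem?_append_left h2]; exact h.2⟩

theorem entryAt_prefix {l l' : List (Entry Op)} {i : ℕ} (hp : l <+: l') (h : i ≤ l.length) :
    entryAt l' i = entryAt l i := by
  rcases Nat.eq_zero_or_pos i with rfl | h0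
  · simp [entryAt]
  · obtain ⟨e, he⟩ := exists_entryAt h0 h
    rw [he, entryAt_of_prefix hp he]

theorem entryAt_take {l : List (Entry Op)} {i k : ℕ} (h : i ≤ k) :
    entryAt (l.take k) i = entryAt l i := by
  unfold entryAt
  split_ifs with h0
  · rfl
  · rw [List.getElem?_take_of_lt (by omega)]

theorem entryAt_concat {l : List (Entry Op)} {i : ℕ} {a e : Entry Op}
    (h : entryAt (l ++ [a]) i = some e) :
    entryAt l i = some e ∨ (i = l.length + 1 ∧ e = a) := by
  have h1 := entryAt_le_length h
  rw [List.length_append, List.length_singleton] at h1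
  rcases Nat.lt_or_ge l.length i with h2 | h2
  · right
    have h3 : i = l.length + 1 := by omega
    subst h3
    have := (entryAt_eq_some.1 h).2
    simp at this
    exact ⟨rfl, this.symm⟩
  · left
    rwa [entryAt_prefix (List.prefix_append l [a]) h2] at h

theorem take_eq_of_prefix {α : Type*} {l l' : List α} {k : ℕ} (hp : l <+: l') (h : k ≤ l.length) :
    l'.take k = l.take k := by
  obtain ⟨t, rfl⟩ := hp
  exact List.take_append_of_le_length h

theorem take_prefix_of_prefix {α : Type*} {l l' : List α} {k : ℕ} (hp : l.take k <+: l')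
    (h : k ≤ l.length) : l.take k = l'.take k := by
  have := List.prefix_iff_eq_take.1 hp
  rwa [List.length_take, min_eq_left h] at this

/-- The log that results from storing the initial segment `p` of the log of a leader: entries
after `p` survive only if `p` was already present. -/
noncomputable def merge (l p : List (Entry Op)) : List (Entry Op) :=
  open Classical in if p <+: l then l else p

theorem merge_of_prefix {l p : List (Entry Op)} (h : p <+: l) : merge l p = l := if_pos h

theorem merge_of_not_prefix {l p : List (Entry Op)} (h : ¬ p <+: l) : merge l p = p := if_neg h

theorem prefix_merge (l p : List (Entry Op)) : p <+: merge l p := by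
  unfold merge
  split_ifs with h
  exacts [h, List.prefix_rfl]

/-- Equal terms mean equal entries, so the scan walks along a common prefix. At the first conflict,
or where the old list ends, what results is exactly `p`. -/
theorem overwrite_eq_merge (l p : List (Entry Op))
    (h : ∀ (k : ℕ) (a b : Entry Op), l[k]? = some a → p[k]? = some b → a.term = b.term → a = b) :
    overwrite l p = merge l p := by
  induction l generalizing p with
  | nil =>
    cases p with
    | nil => simp [overwrite, merge]
    | cons b p => simp [overwrite, merge]
  | cons a l ih =>
    cases p with
    | nil => simp [overwrite, merge]
    | cons b p =>
      rw [overwrite]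
      split_ifs with hab
      · obtain rfl : a = b := h 0 a b rfl rfl hab
        rw [ih p fun k x y hx hy => h (k + 1) x y hx hy]
        by_cases hp : p <+: l
        · rw [merge_of_prefix hp, merge_of_prefix (List.cons_prefix_cons.2 ⟨rfl, hp⟩)]
        · rw [merge_of_not_prefix hp,
            merge_of_not_prefix fun h => hp (List.cons_prefix_cons.1 h).2]
      · rw [merge_of_not_prefix]
        rw [List.cons_prefix_cons]
        rintro ⟨rfl, -⟩
        exact hab rfl

/-! ### Majorities -/

theorem IsMajority.exists_common {Q R : Finset (Fin n)} (hQ : IsMajority Q) (hR : IsMajority R) :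
    ∃ j, j ∈ Q ∧ j ∈ R := by
  by_contra! hne
  have hd : Disjoint Q R := Finset.disjoint_left.2 hne
  have h1 := Finset.card_le_univ (Q ∪ R)
  rw [Finset.card_union_of_disjoint hd, Fintype.card_fin] at h1
  unfold IsMajority at hQ hR
  omega

/-! ### The replicated logs together with their history -/

/-- The terms and logs of all servers, together with the history of the execution: the log
`leaderLog t` of the leader of term `t`, the set of terms in which a leader was elected, and the
last index `acked j t` of the leader's log that server `j` acknowledged to store in term `t`. -/
structure View (n : ℕ) (Op : Type*) where
  term : Fin n → ℕ
  log : Fin n → List (Entry Op)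
  leaderLog : ℕ → List (Entry Op)
  elected : Set ℕ
  acked : Fin n → ℕ → ℕ

namespace View

/-- The history in the second view extends the one in the first. -/
structure Le (A A' : View n Op) : Prop where
  term : ∀ j, A.term j ≤ A'.term j
  leaderLog : ∀ t, A.leaderLog t <+: A'.leaderLog t
  elected : A.elected ⊆ A'.elected
  acked : ∀ j t, A.acked j t ≤ A'.acked j t
  acked_eq : ∀ j t, t < A.term j → A'.acked j t = A.acked j t

theorem Le.rfl {A : View n Op} : A.Le A :=
  ⟨fun _ => le_rfl, fun _ => List.prefix_rfl, subset_rfl, fun _ _ => le_rfl, fun _ _ _ => by rfl⟩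

theorem Le.trans {A B C : View n Op} (h : A.Le B) (h' : B.Le C) : A.Le C :=
  ⟨fun j => (h.term j).trans (h'.term j), fun t => (h.leaderLog t).trans (h'.leaderLog t),
    h.elected.trans h'.elected, fun j t => (h.acked j t).trans (h'.acked j t),
    fun j t ht => (h'.acked_eq j t (ht.trans_le (h.term j))).trans (h.acked_eq j t ht)⟩

/-- Each entry of `l` was created by the leader of its term, and `l` agrees with the log of that
leader up to this entry. -/
def Genuine (A : View n Op) (l : List (Entry Op)) : Prop :=
  ∀ i e, entryAt l i = some e → l.take i <+: A.leaderLog e.term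

/-- The leader of term `t` has the entry `e`, which has term `t`, at index `i`. -/
def Proposal (A : View n Op) (i t : ℕ) (e : Entry Op) : Prop :=
  entryAt (A.leaderLog t) i = some e ∧ e.term = t

/-- A majority stores the log of the leader of term `t` up to index `i` in this term. -/
def Chosen (A : View n Op) (i t : ℕ) : Prop :=
  ∃ Q : Finset (Fin n), IsMajority Q ∧ ∀ j ∈ Q, i ≤ A.acked j t

/-- It is not excluded that a majority will store the log of the leader of term `t` up to index
`i` in this term. -/
def Choosable (A : View n Op) (i t : ℕ) : Prop :=
  ∃ Q : Finset (Fin n), IsMajority Q ∧ ∀ j ∈ Q, i ≤ A.acked j t ∨ A.term j ≤ t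

theorem Chosen.choosable {A : View n Op} {i t : ℕ} (h : A.Chosen i t) : A.Choosable i t :=
  let ⟨Q, hQ, h⟩ := h
  ⟨Q, hQ, fun j hj => .inl (h j hj)⟩

theorem Chosen.mono {A A' : View n Op} (hA : A.Le A') {i t : ℕ} (h : A.Chosen i t) :
    A'.Chosen i t :=
  let ⟨Q, hQ, h⟩ := h
  ⟨Q, hQ, fun j hj => (h j hj).trans (hA.acked j t)⟩

/-- The same majority works earlier: a server already beyond term `t` has frozen its
acknowledgement, and any other server is counted unconditionally. -/
theorem Choosable.anti {A A' : View n Op} (hA : A.Le A') {i t : ℕ} (h : A'.Choosable i t) :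
    A.Choosable i t := by
  obtain ⟨Q, hQ, h⟩ := h
  refine ⟨Q, hQ, fun j hj => ?_⟩
  rcases Nat.lt_or_ge t (A.term j) with ht | ht
  · rcases h j hj with h | h
    · exact .inl (by rwa [hA.acked_eq j t ht] at h)
    · have := hA.term j
      omega
  · exact .inr ht

theorem Proposal.mono {A A' : View n Op} (hA : A.Le A') {i t : ℕ} {e : Entry Op}
    (h : A.Proposal i t e) : A'.Proposal i t e :=
  ⟨entryAt_of_prefix (hA.leaderLog t) h.1, h.2⟩

theorem Proposal.of_le {A A' : View n Op} (hA : A.Le A') {i t : ℕ} {e : Entry Op}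
    (h : A'.Proposal i t e) (hi : i ≤ (A.leaderLog t).length) : A.Proposal i t e :=
  ⟨by rw [← entryAt_prefix (hA.leaderLog t) hi]; exact h.1, h.2⟩

theorem Genuine.mono {A A' : View n Op} (hA : A.Le A') {l : List (Entry Op)} (h : A.Genuine l) :
    A'.Genuine l :=
  fun i e he => (h i e he).trans (hA.leaderLog _)

theorem Genuine.proposal {A : View n Op} {l : List (Entry Op)} (h : A.Genuine l) {i : ℕ}
    {e : Entry Op} (he : entryAt l i = some e) : A.Proposal i e.term e :=
  ⟨entryAt_of_prefix (h i e he) (by rwa [entryAt_take le_rfl]), rfl⟩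

theorem Genuine.take {A : View n Op} {l : List (Entry Op)} (h : A.Genuine l) (k : ℕ) :
    A.Genuine (l.take k) := by
  intro i e he
  have hp := List.take_prefix k l
  rw [← take_eq_of_prefix hp (entryAt_le_length he)]
  exact h i e (entryAt_of_prefix hp he)

theorem Genuine.of_prefix {A : View n Op} {l p : List (Entry Op)} (h : A.Genuine l)
    (hp : p <+: l) : A.Genuine p := by
  rw [List.prefix_iff_eq_take.1 hp]
  exact h.take _

/-- Log matching: both segments are prefixes, of the same length, of the log of one leader. -/
theorem Genuine.take_eq {A : View n Op} {l l' : List (Entry Op)} (h : A.Genuine l)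
    (h' : A.Genuine l') {i : ℕ} {e e' : Entry Op} (he : entryAt l i = some e)
    (he' : entryAt l' i = some e') (ht : e.term = e'.term) : l.take i = l'.take i := by
  have h1 := h i e he
  have h2 := h' i e' he'
  rw [← ht] at h2
  rw [take_prefix_of_prefix h1 (entryAt_le_length he),
    take_prefix_of_prefix h2 (entryAt_le_length he')]

theorem Genuine.entry_eq {A : View n Op} {l l' : List (Entry Op)} (h : A.Genuine l)
    (h' : A.Genuine l') {i : ℕ} {e e' : Entry Op} (he : entryAt l i = some e)
    (he' : entryAt l' i = some e') (ht : e.term = e'.term) : e = e' := by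
  have := h.take_eq h' he he' ht
  rw [← entryAt_take le_rfl, this, entryAt_take le_rfl, he'] at he
  exact (Option.some.inj he).symm

/-- Storing the entries of an AppendEntries request whose consistency check succeeds. -/
theorem Genuine.store_eq {A : View n Op} {l p ents : List (Entry Op)} {v : ℕ} (h : A.Genuine l)
    (h' : A.Genuine (p ++ ents)) (hm : Matches l p.length v)
    (hv : p.length = 0 ∨ ∃ e, entryAt p p.length = some e ∧ e.term = v) :
    store l p.length ents = merge l (p ++ ents) := by
  -- The consistency check compares a single term, but log matching makes it an equality of the
  -- whole segments before the new entries.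
  have hl : l.take p.length = p := by
    rcases Nat.eq_zero_or_pos p.length with h0 | h0
    · simp [List.length_eq_zero_iff.1 h0]
    · obtain h1 | ⟨e, he, rfl⟩ := hv
      · omega
      · rcases hm with hm | hm
        · omega
        · obtain ⟨a, ha, hae⟩ := Option.map_eq_some_iff.1 hm
          have := h.take_eq h' ha (entryAt_of_prefix (List.prefix_append p ents) he) hae
          rw [this]
          simp
  obtain ⟨q, rfl⟩ : ∃ q, l = p ++ q := ⟨l.drop p.length, by
    conv_lhs => rw [← List.take_append_drop p.length l, hl]⟩
  rw [store, List.take_left, List.drop_left, overwrite_eq_merge]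
  · by_cases hp : ents <+: q
    · rw [merge_of_prefix hp, merge_of_prefix ((List.prefix_append_right_inj p).2 hp)]
    · rw [merge_of_not_prefix hp,
        merge_of_not_prefix fun h => hp ((List.prefix_append_right_inj p).1 h)]
  · intro k a b ha hb hab
    refine h.entry_eq h' (i := p.length + k + 1) (e := a) (e' := b) ?_ ?_ hab
    · rw [entryAt_eq_some]
      refine ⟨by omega, ?_⟩
      rw [List.getElem?_append_right (by omega)]
      convert ha using 2
      omega
    · rw [entryAt_eq_some]
      refine ⟨by omega, ?_⟩
      rw [List.getElem?_append_right (by omega)]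
      convert hb using 2
      omega

/-- The properties of the history that do not depend on how leaders are elected. -/
structure Base (A : View n Op) : Prop where
  acked_le : ∀ j t, A.acked j t ≤ (A.leaderLog t).length
  le_term : ∀ j t, 0 < A.acked j t → t ≤ A.term j
  quorum : ∀ t ∈ A.elected, ∃ Q : Finset (Fin n), IsMajority Q ∧ ∀ j ∈ Q, t ≤ A.term j
  leaderLog_eq_nil : ∀ t, t ∉ A.elected → A.leaderLog t = []
  genuine : ∀ j, A.Genuine (A.log j)
  genuine_leader : ∀ t, A.Genuine (A.leaderLog t)
  entry_le : ∀ j i e, entryAt (A.log j) i = some e → e.term ≤ A.term j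
  entry_le_leader : ∀ t i e, entryAt (A.leaderLog t) i = some e → e.term ≤ t

theorem Base.elected_of_entryAt {A : View n Op} (h : A.Base) {t i : ℕ} {e : Entry Op}
    (he : entryAt (A.leaderLog t) i = some e) : t ∈ A.elected := by
  by_contra hn
  rw [h.leaderLog_eq_nil t hn] at he
  have := entryAt_le_length he
  have := entryAt_pos he
  simp at *
  omega

/-- Only entries that existed when the leader of a later term was elected are choosable. -/
theorem Base.le_length_of_choosable {A : View n Op} (h : A.Base) {i u t : ℕ} (hut : u < t)
    (ht : t ∈ A.elected) (hc : A.Choosable i u) : i ≤ (A.leaderLog u).length := by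
  obtain ⟨Q, hQ, hQt⟩ := h.quorum t ht
  obtain ⟨R, hR, hRt⟩ := hc
  obtain ⟨j, hjQ, hjR⟩ := hQ.exists_common hR
  have h1 := hQt j hjQ
  have h2 := h.acked_le j u
  rcases hRt j hjR with h3 | h3 <;> omega

/-- A superseded leader may go on proposing, but its late proposals are not choosable. Claims about
choosable proposals below an elected term thus need checking only for proposals that existed before
the step. -/
theorem Base.proposal_of_le {A A' : View n Op} (h : A.Base) (hA : A.Le A') {i u t : ℕ}
    {e : Entry Op} (hut : u < t) (ht : t ∈ A.elected) (hp : A'.Proposal i u e)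
    (hc : A'.Choosable i u) : A.Proposal i u e ∧ A.Choosable i u :=
  ⟨hp.of_le hA (h.le_length_of_choosable hut ht (hc.anti hA)), hc.anti hA⟩

theorem Base.proposal_of_acked {A A' : View n Op} (h : A.Base) (hA : A.Le A') {i u : ℕ}
    {j : Fin n} {e : Entry Op} (hi : i ≤ A.acked j u) (hp : A'.Proposal i u e) :
    A.Proposal i u e :=
  hp.of_le hA (hi.trans (h.acked_le j u))

/-! ### The ways in which a server changes the history -/

/-- Server `s` enters term `t`. -/
def bump (A : View n Op) (s : Fin n) (t : ℕ) : View n Op :=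
  { A with term := Function.update A.term s t }

/-- Server `s` stores, in term `t`, the initial segment `p` of the log of the leader of term
`t`. -/
noncomputable def accept (A : View n Op) (s : Fin n) (t : ℕ) (p : List (Entry Op)) : View n Op :=
  { A with
    term := Function.update A.term s t
    log := Function.update A.log s (merge (A.log s) p)
    acked := Function.update A.acked s
      (Function.update (A.acked s) t (max (A.acked s t) p.length)) }

/-- Server `s` is leader in term `t` with log `l`. -/
def lead (A : View n Op) (s : Fin n) (t : ℕ) (l : List (Entry Op)) : View n Op :=
  { A with
    log := Function.update A.log s l
    leaderLog := Function.update A.leaderLog t l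
    elected := insert t A.elected
    acked := Function.update A.acked s (Function.update (A.acked s) t l.length) }

theorem le_bump (A : View n Op) {s : Fin n} {t : ℕ} (ht : A.term s ≤ t) : A.Le (A.bump s t) where
  term j := by
    by_cases h : j = s
    · subst h; simpa [bump] using ht
    · simp [bump, h]
  leaderLog _ := List.prefix_rfl
  elected := subset_rfl
  acked _ _ := le_rfl
  acked_eq _ _ _ := rfl

theorem le_accept (A : View n Op) {s : Fin n} {t : ℕ} {p : List (Entry Op)} (ht : A.term s ≤ t) :
    A.Le (A.accept s t p) where
  term j := by
    by_cases h : j = s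
    · subst h; simpa [accept] using ht
    · simp [accept, h]
  leaderLog _ := List.prefix_rfl
  elected := subset_rfl
  acked j u := by
    by_cases h : j = s
    · subst h
      by_cases hu : u = t
      · subst hu; simp [accept]
      · simp [accept, hu]
    · simp [accept, h]
  acked_eq j u hu := by
    by_cases h : j = s
    · subst h
      have : u ≠ t := by omega
      simp [accept, this]
    · simp [accept, h]

theorem le_lead {A : View n Op} (hA : A.Base) {s : Fin n} {t : ℕ} {l : List (Entry Op)}
    (ht : A.term s = t) (hl : A.leaderLog t <+: l) : A.Le (A.lead s t l) where
  term _ := le_rfl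
  leaderLog u := by
    by_cases hu : u = t
    · subst hu; simpa [lead] using hl
    · simp [lead, hu]
  elected := Set.subset_insert _ _
  acked j u := by
    by_cases h : j = s
    · subst h
      by_cases hu : u = t
      · subst hu
        -- Replacing the acknowledgement by `l.length` loses nothing: the old one was bounded by the
        -- old leader log, a prefix of `l`.
        simpa [lead] using (hA.acked_le _ _).trans hl.length_le
      · simp [lead, hu]
    · simp [lead, h]
  acked_eq j u hu := by
    by_cases h : j = s
    · subst h
      have : u ≠ t := by omega
      simp [lead, this]
    · simp [lead, h]

theorem Base.bump {A : View n Op} (hA : A.Base) {s : Fin n} {t : ℕ} (ht : A.term s ≤ t) :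
    (A.bump s t).Base where
  acked_le := hA.acked_le
  le_term j u h := (hA.le_term j u h).trans ((A.le_bump ht).term j)
  quorum u hu := by
    obtain ⟨Q, hQ, h⟩ := hA.quorum u hu
    exact ⟨Q, hQ, fun j hj => (h j hj).trans ((A.le_bump ht).term j)⟩
  leaderLog_eq_nil := hA.leaderLog_eq_nil
  genuine j := hA.genuine j
  genuine_leader u := hA.genuine_leader u
  entry_le j i e h := (hA.entry_le j i e h).trans ((A.le_bump ht).term j)
  entry_le_leader := hA.entry_le_leader

theorem Base.accept {A : View n Op} (hA : A.Base) {s : Fin n} {t : ℕ} {p : List (Entry Op)}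
    (ht : A.term s ≤ t) (hp : p <+: A.leaderLog t) : (A.accept s t p).Base := by
  have hle := A.le_accept (p := p) ht
  refine ⟨fun j u => ?_, fun j u h => ?_, fun u hu => ?_, hA.leaderLog_eq_nil, fun j => ?_,
    fun u => (hA.genuine_leader u).mono hle, fun j i e h => ?_, hA.entry_le_leader⟩
  · have h1 := hA.acked_le j u
    by_cases h : j = s
    · subst h
      by_cases hu : u = t
      · subst hu; simpa [View.accept] using ⟨h1, hp.length_le⟩
      · simpa [View.accept, hu] using h1
    · simpa [View.accept, h] using h1
  · by_cases hj : j = s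
    · subst hj
      by_cases hu : u = t
      · subst hu; simp [View.accept]
      · refine (hA.le_term j u ?_).trans (hle.term j)
        simpa [View.accept, hu] using h
    · refine (hA.le_term j u ?_).trans (hle.term j)
      simpa [View.accept, hj] using h
  · obtain ⟨Q, hQ, h⟩ := hA.quorum u hu
    exact ⟨Q, hQ, fun j hj => (h j hj).trans (hle.term j)⟩
  · refine Genuine.mono hle ?_
    by_cases hj : j = s
    · subst hj
      simp only [View.accept, Function.update_self]
      unfold merge
      split_ifs
      exacts [hA.genuine j, (hA.genuine_leader t).of_prefix hp]
    · simpa [View.accept, hj] using hA.genuine j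
  · by_cases hj : j = s
    · subst hj
      simp only [View.accept, Function.update_self] at h ⊢
      unfold merge at h
      split_ifs at h
      exacts [(hA.entry_le j i e h).trans ht,
        hA.entry_le_leader t i e (entryAt_of_prefix hp h)]
    · refine (hA.entry_le j i e ?_).trans (hle.term j)
      simpa [View.accept, hj] using h

/-- Serves elections and client requests alike. An entry of `l` either has term `t`, and `l` itself
vouches for it, or is inherited from an earlier term, and a leader log that can only grow vouches
for it. -/
theorem Base.lead {A : View n Op} (hA : A.Base) {s : Fin n} {t : ℕ} {l : List (Entry Op)}
    (ht : A.term s = t) (hl : A.leaderLog t <+: l)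
    (hQ : ∃ Q : Finset (Fin n), IsMajority Q ∧ ∀ j ∈ Q, t ≤ A.term j)
    (hent : ∀ i e, entryAt l i = some e →
      e.term = t ∨ (e.term < t ∧ l.take i <+: A.leaderLog e.term)) :
    (A.lead s t l).Base := by
  have hle := le_lead hA ht hl
  have hgen : (A.lead s t l).Genuine l := by
    intro i e he
    rcases hent i e he with h | ⟨h, h'⟩
    · rw [h]; simpa [View.lead] using List.take_prefix i l
    · exact h'.trans (hle.leaderLog _)
  have hent' : ∀ i e, entryAt l i = some e → e.term ≤ t := fun i e he => by
    rcases hent i e he with h | ⟨h, -⟩ <;> omega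
  refine ⟨fun j u => ?_, fun j u h => ?_, fun u hu => ?_, fun u hu => ?_, fun j => ?_,
    fun u => ?_, fun j i e h => ?_, fun u i e h => ?_⟩
  · by_cases h : j = s ∧ u = t
    · obtain ⟨rfl, rfl⟩ := h
      simp [View.lead]
    · refine le_trans ?_ ((hA.acked_le j u).trans (hle.leaderLog u).length_le)
      by_cases hj : j = s
      · subst hj
        have : u ≠ t := fun hu => h ⟨rfl, hu⟩
        simp [View.lead, this]
      · simp [View.lead, hj]
  · by_cases hj : j = s
    · subst hj
      by_cases hu : u = t
      · subst hu; exact ht.ge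
      · refine hA.le_term j u ?_
        simpa [View.lead, hu] using h
    · refine hA.le_term j u ?_
      simpa [View.lead, hj] using h
  · rcases hu with rfl | hu
    exacts [hQ, hA.quorum u hu]
  · have h1 : u ≠ t := fun h => hu (.inl h)
    simpa [View.lead, h1] using hA.leaderLog_eq_nil u fun h => hu (.inr h)
  · by_cases hj : j = s
    · subst hj; simpa [View.lead] using hgen
    · simpa [View.lead, hj] using (hA.genuine j).mono hle
  · by_cases hu : u = t
    · subst hu; simpa [View.lead] using hgen
    · simpa [View.lead, hu] using (hA.genuine_leader u).mono hle
  · by_cases hj : j = s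
    · subst hj
      rw [← ht] at hent'
      exact hent' i e (by simpa [View.lead] using h)
    · exact hA.entry_le j i e (by simpa [View.lead, hj] using h)
  · by_cases hu : u = t
    · subst hu; exact hent' i e (by simpa [View.lead] using h)
    · exact hA.entry_le_leader u i e (by simpa [View.lead, hu] using h)

/-- The hypothesis on the entries in `Base.lead` when the leader appends an entry. -/
theorem Base.entry_concat {A : View n Op} (hA : A.Base) {t : ℕ} {a : Entry Op} (ha : a.term = t)
    {i : ℕ} {e : Entry Op} (he : entryAt (A.leaderLog t ++ [a]) i = some e) :
    e.term = t ∨ (e.term < t ∧ (A.leaderLog t ++ [a]).take i <+: A.leaderLog e.term) := by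
  rcases entryAt_concat he with h | ⟨-, rfl⟩
  · have h1 := hA.entry_le_leader t i e h
    have h2 := hA.genuine_leader t i e h
    rw [← take_eq_of_prefix (List.prefix_append _ [a]) (entryAt_le_length h)] at h2
    rcases h1.eq_or_lt with h1 | h1
    exacts [.inl h1, .inr ⟨h1, h2⟩]
  · exact .inl ha

/-! ### AppendEntries requests as segments of leader logs -/

/-- An AppendEntries request contains a segment of the log of the leader of its term. -/
def AppendOk (A : View n Op) (a : AppendArgs Op) : Prop :=
  a.term ∈ A.elected ∧ ∃ p : List (Entry Op), p.length = a.prevLogIndex ∧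
    p ++ a.entries <+: A.leaderLog a.term ∧
    (p.length = 0 ∨ ∃ e, entryAt p p.length = some e ∧ e.term = a.prevLogTerm)

theorem AppendOk.mono {A A' : View n Op} (hA : A.Le A') {a : AppendArgs Op} (h : A.AppendOk a) :
    A'.AppendOk a :=
  let ⟨ht, p, h1, h2, h3⟩ := h
  ⟨hA.elected ht, p, h1, h2.trans (hA.leaderLog _), h3⟩

/-- The requests that a leader sends to a server with next index `k`. -/
theorem appendOk_of_leader {A : View n Op} {a : AppendArgs Op} {k : ℕ} (ht : a.term ∈ A.elected)
    (h1 : 1 ≤ k) (hk : k ≤ (A.leaderLog a.term).length + 1) (hi : a.prevLogIndex = k - 1)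
    (hv : a.prevLogTerm = termAt (A.leaderLog a.term) (k - 1))
    (he : a.entries <+: (A.leaderLog a.term).drop (k - 1)) : A.AppendOk a := by
  have hlen : ((A.leaderLog a.term).take (k - 1)).length = k - 1 := by
    rw [List.length_take]; omega
  refine ⟨ht, (A.leaderLog a.term).take (k - 1), by omega, ?_, ?_⟩
  · conv_rhs => rw [← List.take_append_drop (k - 1) (A.leaderLog a.term)]
    exact (List.prefix_append_right_inj _).2 he
  · rw [hlen]
    rcases Nat.eq_zero_or_pos (k - 1) with h0 | h0
    · exact .inl h0
    · obtain ⟨e, he⟩ := exists_entryAt (l := A.leaderLog a.term) h0 (by omega)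
      refine .inr ⟨e, by rwa [entryAt_take le_rfl], ?_⟩
      rw [hv, termAt, he]
      rfl

end View

end Consensus

namespace Consensus.Paxos

variable {n : ℕ} {Op : Type*}

/-! ### Paxos: safety of the logs -/

/-- An entry with index `i` has been chosen in a term up to `v`. -/
def Settled (A : View n Op) (i v : ℕ) : Prop :=
  ∃ u ≤ v, A.Chosen i u ∧ ∃ e, A.Proposal i u e

theorem Settled.mono {A A' : View n Op} (hA : A.Le A') {i v : ℕ} (h : Settled A i v) :
    Settled A' i v :=
  let ⟨u, hu, hc, e, he⟩ := h
  ⟨u, hu, hc.mono hA, e, he.mono hA⟩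

/-- Entries that may still become chosen determine the operations proposed in later terms. -/
structure LogInv (A : View n Op) : Prop extends A.Base where
  agree : ∀ i u t e e', u < t → A.Proposal i u e → A.Proposal i t e' → A.Choosable i u →
    e.op = e'.op
  complete : ∀ i u t e, u < t → t ∈ A.elected → A.Proposal i u e → A.Choosable i u →
    i ≤ (A.leaderLog t).length
  settled : ∀ t i e, entryAt (A.leaderLog t) i = some e → e.term = t ∨ Settled A i e.term
  stored : ∀ j i u e, A.Proposal i u e → i ≤ A.acked j u → A.Choosable i u →
    ∃ e', entryAt (A.log j) i = some e' ∧ (u ≤ e'.term ∨ Settled A i e'.term)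

namespace LogInv

theorem op_eq {A : View n Op} (hA : LogInv A) {i u t : ℕ} {e e' : Entry Op} (hut : u ≤ t)
    (he : A.Proposal i u e) (he' : A.Proposal i t e') (hc : A.Choosable i u) : e.op = e'.op := by
  rcases hut.eq_or_lt with rfl | hut
  · rw [Option.some.inj (he.1.symm.trans he'.1)]
  · exact hA.agree i u t e e' hut he he' hc

/-- Each entry has the operation of the chosen proposal that settles it. Of these two proposals the
earlier one, being choosable, dictates the operation of the later. -/
theorem op_eq_of_settled {A : View n Op} (hA : LogInv A) {i v v' : ℕ} {e e' : Entry Op}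
    (he : A.Proposal i v e) (he' : A.Proposal i v' e') (h : Settled A i v)
    (h' : Settled A i v') : e.op = e'.op := by
  obtain ⟨u, hu, hc, a, ha⟩ := h
  obtain ⟨u', hu', hc', a', ha'⟩ := h'
  rw [← hA.op_eq hu ha he hc.choosable, ← hA.op_eq hu' ha' he' hc'.choosable]
  rcases le_total u u' with h | h
  · exact hA.op_eq h ha ha' hc.choosable
  · exact (hA.op_eq h ha' ha hc'.choosable).symm

theorem bump {A : View n Op} (hA : LogInv A) {s : Fin n} {t : ℕ} (ht : A.term s ≤ t) :
    LogInv (A.bump s t) := by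
  have hle := A.le_bump ht
  exact ⟨hA.toBase.bump ht, fun i u v e e' huv he he' hc =>
    hA.agree i u v e e' huv he he' (hc.anti hle), fun i u v e huv hv he hc =>
    hA.complete i u v e huv hv he (hc.anti hle), fun v i e he =>
    (hA.settled v i e he).imp_right (.mono hle), fun j i u e he hi hc =>
    let ⟨e', h1, h2⟩ := hA.stored j i u e he hi (hc.anti hle)
    ⟨e', h1, h2.imp_right (.mono hle)⟩⟩

/-- Something can be lost only if `p` replaces the log, so the point is that `p` reaches index `i`.
For `u < t` this is `hfull`. For `u = t` the stored entry has term `t` itself, so the log up to `i`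
and `p` are prefixes of the same leader log, and a shorter `p` would not have replaced anything. The
new entry has term `t` or is settled. -/
theorem merge_of_le {A : View n Op} (hA : LogInv A) {s : Fin n} {t : ℕ} {p : List (Entry Op)}
    (ht : A.term s ≤ t) (hp : p <+: A.leaderLog t)
    (hfull : p <+: A.log s ∨
      ∀ i u e, u < t → A.Proposal i u e → A.Choosable i u → i ≤ p.length)
    {i u : ℕ} {e e' : Entry Op} (hut : u ≤ t) (he : A.Proposal i u e) (hc : A.Choosable i u)
    (he' : entryAt (A.log s) i = some e') (hu : u ≤ e'.term) :
    ∃ e'', entryAt (merge (A.log s) p) i = some e'' ∧ (u ≤ e''.term ∨ Settled A i e''.term) := by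
  by_cases hpl : p <+: A.log s
  · exact ⟨e', by rwa [merge_of_prefix hpl], .inl hu⟩
  · have hi : i ≤ p.length := by
      rcases hut.eq_or_lt with rfl | hlt
      · by_contra! hi
        have h1 := hA.entry_le s i e' he'
        have h2 : e'.term = u := by omega
        have h3 := hA.genuine s i e' he'
        rw [h2] at h3
        refine hpl (.trans (l₂ := (A.log s).take i) ?_ (List.take_prefix _ _))
        refine List.prefix_of_prefix_length_le hp h3 ?_
        rw [List.length_take]
        have := entryAt_le_length he'
        omega
      · exact hfull.resolve_left hpl i u e hlt he hc
    obtain ⟨e'', he''⟩ := exists_entryAt (entryAt_pos he') hi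
    refine ⟨e'', by rwa [merge_of_not_prefix hpl], ?_⟩
    rcases hA.settled t i e'' (entryAt_of_prefix hp he'') with h | h
    · exact .inl (by omega)
    · exact .inr h

/-- The term `u` in which the index was chosen is at most that of the stored entry, so `merge_of_le`
applies to `u`. A replacement of term at least `u` is settled by the same chosen proposal. -/
theorem merge_of_settled {A : View n Op} (hA : LogInv A) {s : Fin n} {t : ℕ}
    {p : List (Entry Op)} (ht : A.term s ≤ t) (hp : p <+: A.leaderLog t)
    (hfull : p <+: A.log s ∨
      ∀ i u e, u < t → A.Proposal i u e → A.Choosable i u → i ≤ p.length)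
    {i : ℕ} {e' : Entry Op} (he' : entryAt (A.log s) i = some e') (hs : Settled A i e'.term) :
    ∃ e'', entryAt (merge (A.log s) p) i = some e'' ∧ Settled A i e''.term := by
  obtain ⟨u, hu, hc, e, he⟩ := hs
  have h1 := hA.entry_le s i e' he'
  obtain ⟨e'', h2, h3⟩ := hA.merge_of_le ht hp hfull (by omega) he hc.choosable he' hu
  exact ⟨e'', h2, h3.elim (fun h => ⟨u, h, hc, e, he⟩) id⟩

theorem accept {A : View n Op} (hA : LogInv A) {s : Fin n} {t : ℕ} {p : List (Entry Op)}
    (ht : A.term s ≤ t) (hp : p <+: A.leaderLog t)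
    (hfull : p <+: A.log s ∨
      ∀ i u e, u < t → A.Proposal i u e → A.Choosable i u → i ≤ p.length) :
    LogInv (A.accept s t p) := by
  have hle := A.le_accept (p := p) ht
  refine ⟨hA.toBase.accept ht hp, fun i u v e e' huv he he' hc =>
    hA.agree i u v e e' huv he he' (hc.anti hle), fun i u v e huv hv he hc =>
    hA.complete i u v e huv hv he (hc.anti hle), fun v i e he =>
    (hA.settled v i e he).imp_right (.mono hle), fun j i u e he hi hc => ?_⟩
  replace he : A.Proposal i u e := he
  replace hc := hc.anti hle
  suffices h : ∃ e', entryAt ((A.accept s t p).log j) i = some e' ∧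
      (u ≤ e'.term ∨ Settled A i e'.term) from
    let ⟨e', h1, h2⟩ := h
    ⟨e', h1, h2.imp_right (.mono hle)⟩
  by_cases hj : j = s
  · subst hj
    simp only [View.accept, Function.update_self] at hi ⊢
    -- Either the index is covered by the present request, and the leader's own entry is now stored,
    -- or its acknowledgement is an old one.
    by_cases h1 : u = t ∧ i ≤ p.length
    · obtain ⟨rfl, h1⟩ := h1
      refine ⟨e, entryAt_of_prefix (prefix_merge _ _) ?_, .inl he.2.ge⟩
      rw [← entryAt_prefix hp h1]
      exact he.1
    · have hi' : i ≤ A.acked j u := by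
        by_cases hu : u = t
        · subst hu
          simp only [Function.update_self, le_max_iff] at hi
          exact hi.resolve_right fun h => h1 ⟨rfl, h⟩
        · simpa [hu] using hi
      have hut : u ≤ t := (hA.le_term j u ((entryAt_pos he.1).trans_le hi')).trans ht
      obtain ⟨e', h2, h3 | h3⟩ := hA.stored j i u e he hi' hc
      · exact hA.merge_of_le ht hp hfull hut he hc h2 h3
      · obtain ⟨e'', h4, h5⟩ := hA.merge_of_settled ht hp hfull h2 h3
        exact ⟨e'', h4, .inr h5⟩
  · simp only [View.accept, ne_eq, hj, not_false_eq_true, Function.update_of_ne] at hi ⊢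
    exact hA.stored j i u e he hi hc

/-- The common core of elections and client requests. Only the leader log of term `t` changes, so
the hypotheses concern `l` alone. They refer to choosability in the old history, which follows from
choosability in the new one. -/
theorem lead {A : View n Op} (hA : LogInv A) {s : Fin n} {t : ℕ} {l : List (Entry Op)}
    (hB : (A.lead s t l).Base) (ht : A.term s = t) (hl : A.leaderLog t <+: l)
    (hagree : ∀ i u e e', u < t → A.Proposal i u e → A.Choosable i u → entryAt l i = some e' →
      e'.term = t → e.op = e'.op)
    (hcomplete : ∀ i u e, u < t → A.Proposal i u e → A.Choosable i u → i ≤ l.length)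
    (hsettled : ∀ i e, entryAt l i = some e → e.term = t ∨ Settled A i e.term) :
    LogInv (A.lead s t l) := by
  have hle := View.le_lead hA.toBase ht hl
  have hself : (A.lead s t l).leaderLog t = l := by simp [View.lead]
  have hne : ∀ u, u ≠ t → (A.lead s t l).leaderLog u = A.leaderLog u := fun u hu => by
    simp [View.lead, hu]
  refine ⟨hB, fun i u v e e' huv he he' hc => ?_, fun i u v e huv hv he hc => ?_,
    fun v i e he => ?_, fun j i u e he hi hc => ?_⟩
  · by_cases hv : v = t
    · subst hv
      rw [View.Proposal, hne u (by omega)] at he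
      rw [View.Proposal, hself] at he'
      exact hagree i u e e' huv he (hc.anti hle) he'.1 he'.2
    · rw [View.Proposal, hne v hv] at he'
      obtain ⟨h1, h2⟩ := hA.proposal_of_le hle huv (hA.elected_of_entryAt he'.1) he hc
      exact hA.agree i u v e e' huv h1 he' h2
  · by_cases hv' : v = t
    · subst hv'
      rw [View.Proposal, hne u (by omega)] at he
      rw [hself]
      exact hcomplete i u e huv he (hc.anti hle)
    · have hv : v ∈ A.elected := hv.resolve_left hv'
      obtain ⟨h1, h2⟩ := hA.proposal_of_le hle huv hv he hc
      rw [hne v hv']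
      exact hA.complete i u v e huv hv h1 h2
  · by_cases hv : v = t
    · subst hv
      rw [hself] at he
      exact (hsettled i e he).imp_right (.mono hle)
    · rw [hne v hv] at he
      exact (hA.settled v i e he).imp_right (.mono hle)
  · by_cases hj : j = s
    · subst hj
      have hlog : (A.lead j t l).log j = l := by simp [View.lead]
      rw [hlog]
      have hut : u ≤ t := ht ▸ hB.le_term j u ((entryAt_pos he.1).trans_le hi)
      -- The leader's own acknowledgements: in its own term it holds the proposal itself, and for
      -- earlier terms `hcomplete` provides an entry at the index, which has term `t` or is settled.
      rcases hut.eq_or_lt with rfl | hut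
      · rw [View.Proposal, hself] at he
        exact ⟨e, he.1, .inl he.2.ge⟩
      · have he' := he
        rw [View.Proposal, hne u (by omega)] at he'
        obtain ⟨e', h1⟩ := exists_entryAt (entryAt_pos he.1)
          (hcomplete i u e hut he' (hc.anti hle))
        refine ⟨e', h1, ?_⟩
        rcases hsettled i e' h1 with h | h
        · exact .inl (by omega)
        · exact .inr (h.mono hle)
    · have hi' : i ≤ A.acked j u := by simpa [View.lead, hj] using hi
      have hlog : (A.lead s t l).log j = A.log j := by simp [View.lead, hj]
      obtain ⟨e', h1, h2⟩ := hA.stored j i u e (hA.proposal_of_acked hle hi' he) hi' (hc.anti hle)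
      exact ⟨e', by rwa [hlog], h2.imp_right (.mono hle)⟩

/-- Indices still choosable in earlier terms lie within the log that the leader already has, so the
appended entry has nothing to agree with. -/
theorem concat {A : View n Op} (hA : LogInv A) {s : Fin n} {t : ℕ} {a : Entry Op}
    (ht : A.term s = t) (hel : t ∈ A.elected) (ha : a.term = t) :
    LogInv (A.lead s t (A.leaderLog t ++ [a])) := by
  refine hA.lead (hA.toBase.lead ht (List.prefix_append _ _) (hA.quorum t hel) fun i e he =>
    hA.entry_concat ha he) ht (List.prefix_append _ _) (fun i u e e' hu he hc he' hv => ?_)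
    (fun i u e hu he hc => ?_) (fun i e he => ?_)
  · have h1 := hA.complete i u t e hu hel he hc
    rw [entryAt_prefix (List.prefix_append _ _) h1] at he'
    exact hA.agree i u t e e' hu he ⟨he', hv⟩ hc
  · have := hA.complete i u t e hu hel he hc
    simp
    omega
  · rcases entryAt_concat he with h | ⟨-, rfl⟩
    exacts [hA.settled t i e h, .inl ha]

end LogInv

/-! ### Paxos: elections -/

/-- The entries `ents` reported for the election in term `t` include, for each index after `c`, one
that is recent enough in view of what server `j` acknowledged before. -/
def Reported (A : View n Op) (j : Fin n) (t c : ℕ) (ents : Set (ℕ × Entry Op)) : Prop :=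
  ∀ i u e, c < i → u < t → A.Proposal i u e → i ≤ A.acked j u → A.Choosable i u →
    ∃ e', (i, e') ∈ ents ∧ (u ≤ e'.term ∨ Settled A i e'.term)

/-- A report cannot become outdated: a voter that has reached term `t` never changes its
acknowledgements for earlier terms. -/
theorem Reported.mono {A A' : View n Op} (hB : A.Base) (hA : A.Le A') {j : Fin n} {t c : ℕ}
    {ents ents' : Set (ℕ × Entry Op)} (h : Reported A j t c ents) (ht : t ≤ A.term j)
    (hents : ents ⊆ ents') : Reported A' j t c ents' := by
  intro i u e hi hu he hj hc
  rw [hA.acked_eq j u (by omega)] at hj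
  obtain ⟨e', h1, h2⟩ := h i u e hi hu (hB.proposal_of_acked hA hj he) hj (hc.anti hA)
  exact ⟨e', hents h1, h2.imp_right (.mono hA)⟩

theorem LogInv.reported {A : View n Op} (hA : LogInv A) (j : Fin n) (t c : ℕ) :
    Reported A j t c (indexed c ((A.log j).drop c)) := by
  intro i u e hi hu he hj hc
  obtain ⟨e', h1, h2⟩ := hA.stored j i u e he hj hc
  -- The first reported entry, at position `0`, has index `c + 1`.
  refine ⟨e', ⟨i - c - 1, ?_, ?_⟩, h2⟩
  · rw [List.getElem?_drop]
    convert (entryAt_eq_some.1 h1).2 using 2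
    omega
  · dsimp only
    omega

theorem LogInv.proposal_of_mem_indexed {A : View n Op} (hA : LogInv A) {j : Fin n} {c : ℕ}
    {p : ℕ × Entry Op} (hp : p ∈ indexed c ((A.log j).drop c)) :
    A.Proposal p.1 p.2.term p.2 := by
  obtain ⟨k, h1, h2⟩ := hp
  refine (hA.genuine j).proposal ?_
  rw [entryAt_eq_some]
  refine ⟨by omega, ?_⟩
  rw [List.getElem?_drop] at h1
  convert h1 using 2
  omega

/-- The heart of Paxos. Up to `c` the candidate keeps settled entries. Beyond `c` every index
choosable in an earlier term occurs in some voter's report, and choosing the greatest reported term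
carries agreement over to term `t`. -/
theorem LogInv.elect {A : View n Op} (hA : LogInv A) {s : Fin n} {t c : ℕ}
    {ents : Set (ℕ × Entry Op)} {Q : Finset (Fin n)} {l : List (Entry Op)} (ht : A.term s = t)
    (hel : t ∉ A.elected)
    (hcommit : ∀ i, 0 < i → i ≤ c → ∃ e, entryAt (A.log s) i = some e ∧ Settled A i e.term)
    (hents : ∀ p ∈ ents, A.Proposal p.1 p.2.term p.2) (hQ : IsMajority Q)
    (hvotes : ∀ j ∈ Q, t ≤ A.term j ∧ Reported A j t c ents)
    (hl : Adopts t c (A.log s) ents l) : LogInv (A.lead s t l) := by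
  have hnil : A.leaderLog t <+: l := by
    rw [hA.leaderLog_eq_nil t hel]; exact List.nil_prefix
  have hold : ∀ i e, i ≤ c → entryAt l i = some e →
      entryAt (A.log s) i = some e ∧ e.term < t := by
    intro i e hi he
    rw [hl.1 i hi] at he
    have h1 := hA.entry_le s i e he
    -- An entry of term `t` would have been created by a leader of term `t`, and there was none.
    have h2 : e.term ≠ t := fun h =>
      hel (h ▸ hA.elected_of_entryAt ((hA.genuine s).proposal he).1)
    exact ⟨he, by omega⟩
  have hnew : ∀ i e, c < i → entryAt l i = some e → e.term = t := by
    intro i e hi he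
    rcases hl.2 i hi with ⟨-, h⟩ | ⟨a, -, -, h⟩
    · rw [h] at he; cases he
    · rw [h] at he; cases he; rfl
  -- Quorum intersection: a voter in the majority that witnesses choosability has already left term
  -- `u`, hence really acknowledged the index, and its report is binding.
  have hreport : ∀ i u e, c < i → u < t → A.Proposal i u e → A.Choosable i u →
      ∃ e', (i, e') ∈ ents ∧ (u ≤ e'.term ∨ Settled A i e'.term) := by
    intro i u e hi hu he hc
    obtain ⟨R, hR, hRc⟩ := hc
    obtain ⟨j, hjQ, hjR⟩ := hQ.exists_common hR
    obtain ⟨h1, h2⟩ := hvotes j hjQ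
    refine h2 i u e hi hu he ?_ ⟨R, hR, hRc⟩
    rcases hRc j hjR with h | h
    · exact h
    · omega
  have hB : (A.lead s t l).Base := by
    refine hA.toBase.lead ht hnil ⟨Q, hQ, fun j hj => (hvotes j hj).1⟩ fun i e he => ?_
    rcases Nat.lt_or_ge c i with hi | hi
    · exact .inl (hnew i e hi he)
    · obtain ⟨h1, h2⟩ := hold i e hi he
      refine .inr ⟨h2, ?_⟩
      have : l.take i = (A.log s).take i := by
        refine List.ext_getElem? fun k => ?_
        rcases Nat.lt_or_ge k i with hk | hk
        · have := hl.1 (k + 1) (by omega)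
          rw [List.getElem?_take_of_lt hk, List.getElem?_take_of_lt hk]
          simpa [entryAt] using this
        · rw [List.getElem?_eq_none, List.getElem?_eq_none] <;>
            exact (List.length_take_le _ _).trans hk
      rw [this]
      exact hA.genuine s i e h1
  refine hA.lead hB ht hnil (fun i u e e' hu he hc he' hv => ?_) (fun i u e hu he hc => ?_)
    fun i e he => ?_
  -- Retained entries have terms below `t`, so a proposal of term `t` lies beyond `c`.
  · have hi : c < i := by
      by_contra! hi
      have := (hold i e' hi he').2
      omega
    obtain ⟨b, hb, hb'⟩ := hreport i u e hi hu he hc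
    rcases hl.2 i hi with ⟨h, -⟩ | ⟨a, ha, hmax, h⟩
    · exact absurd hb (h b)
    · rw [h] at he'
      cases he'
      have h1 := hmax b hb
      have h2 : A.Proposal i a.term a := hents _ ha
      change e.op = a.op
      rcases hb' with hb' | ⟨u', hu', hc', e₁, he₁⟩
      · exact hA.op_eq (hb'.trans h1) he h2 hc
      -- The reported entry may have a term below `u`, but then a proposal chosen in term `u'` links
      -- the two operations, whichever of `u` and `u'` is smaller.
      · rw [← hA.op_eq (hu'.trans h1) he₁ h2 hc'.choosable]
        rcases le_total u u' with h | h
        · exact hA.op_eq h he he₁ hc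
        · exact (hA.op_eq h he₁ he hc'.choosable).symm
  · rcases Nat.lt_or_ge c i with hi | hi
    · obtain ⟨b, hb, -⟩ := hreport i u e hi hu he hc
      rcases hl.2 i hi with ⟨h, -⟩ | ⟨a, -, -, h⟩
      · exact absurd hb (h b)
      · exact entryAt_le_length h
    · obtain ⟨b, hb, -⟩ := hcommit i (entryAt_pos he.1) hi
      rw [← hl.1 i hi] at hb
      exact entryAt_le_length hb
  · rcases Nat.lt_or_ge c i with hi | hi
    · exact .inl (hnew i e hi he)
    · right
      have h1 := (hold i e hi he).1
      obtain ⟨b, hb, hb'⟩ := hcommit i (entryAt_pos he) hi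
      rw [h1] at hb
      cases hb
      exact hb'

/-! ### Paxos: servers and messages -/

/-- The clause `owner` mentions only the persistent term, so it survives crashes. It ensures that a
timeout leads to a term that has had no leader. The clause for leaders is what makes `matchIndex`
evidence for acknowledgements. -/
structure ServerOk (A : View n Op) (s : Fin n) (x : Server n Op) : Prop where
  owner : ∀ t ∈ A.elected, t % n = s → t ≤ x.currentTerm
  commit : ∀ i, 0 < i → i ≤ x.commitIndex →
    ∃ e, entryAt x.log i = some e ∧ Settled A i e.term
  leader : x.role = .leader → x.currentTerm % n = s ∧ x.currentTerm ∈ A.elected ∧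
    A.leaderLog x.currentTerm = x.log ∧ x.log.length ≤ A.acked s x.currentTerm ∧
    ∀ j, x.matchIndex j ≤ A.acked j x.currentTerm ∧ 1 ≤ x.nextIndex j ∧
      x.nextIndex j ≤ x.log.length + 1
  candidate : x.role = .candidate → x.currentTerm % n = s ∧ x.currentTerm ∉ A.elected ∧
    (∀ p ∈ x.entries, A.Proposal p.1 p.2.term p.2) ∧
    ∀ j ∈ x.votes, x.currentTerm ≤ A.term j ∧ Reported A j x.currentTerm x.commitIndex x.entries

/-- Server `x` asked for votes in term `t` with commit index `c`. -/
def RequestOk (x : Server n Op) (t c : ℕ) : Prop :=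
  t ≤ x.currentTerm ∧ (x.role = .candidate → x.currentTerm = t → x.commitIndex = c)

/-- Negative replies promise nothing. A heartbeat deletes nothing, so only requests with entries
must cover all indices choosable in earlier terms. The commit index is vouched for only as far as
the request reaches, since the receiver caps it there. -/
def MessageOk (A : View n Op) (srv : Fin n → Server n Op) (m : Message n (Payload Op)) : Prop :=
  match m.payload with
  | .requestVote t c => RequestOk (srv m.src) t c
  | .voteReply t c _ granted ents => granted = true →
      RequestOk (srv m.dst) t c ∧ t ≤ A.term m.src ∧
      (∀ p ∈ indexed c ents, A.Proposal p.1 p.2.term p.2) ∧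
      Reported A m.src t c (indexed c ents)
  | .appendEntries a => A.AppendOk a ∧
      (a.entries = [] ∨
        ∀ i u e, u < a.term → A.Proposal i u e → A.Choosable i u → i ≤ a.lastIndex) ∧
      ∀ i, 0 < i → i ≤ a.leaderCommit → i ≤ a.lastIndex →
        ∃ e, entryAt (A.leaderLog a.term) i = some e ∧ Settled A i e.term
  | .appendReply a _ success => success = true → a.lastIndex ≤ A.acked m.src a.term

/-- What the history says about a single server. -/
structure Local (A : View n Op) (s : Fin n) (x : Server n Op) : Prop where
  inv : LogInv A
  term_eq : A.term s = x.currentTerm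
  log_eq : A.log s = x.log
  ok : ServerOk A s x

/-- A step of server `s` with its states and histories before and after. -/
structure Trans (A : View n Op) (s : Fin n) (x : Server n Op) (A' : View n Op)
    (x' : Server n Op) : Prop where
  le : A.Le A'
  term_ne : ∀ j, j ≠ s → A'.term j = A.term j
  log_ne : ∀ j, j ≠ s → A'.log j = A.log j
  frame : ∀ t, (A'.leaderLog t = A.leaderLog t ∧ (t ∈ A'.elected → t ∈ A.elected)) ∨ t % n = s
  loc : Local A' s x'
  term_le : x.currentTerm ≤ x'.currentTerm
  candidate : x'.role = .candidate → x'.currentTerm = x.currentTerm →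
    x.role = .candidate ∧ x'.commitIndex = x.commitIndex

theorem Trans.trans {A B C : View n Op} {s : Fin n} {x y z : Server n Op}
    (h : Trans A s x B y) (h' : Trans B s y C z) : Trans A s x C z where
  le := h.le.trans h'.le
  term_ne j hj := (h'.term_ne j hj).trans (h.term_ne j hj)
  log_ne j hj := (h'.log_ne j hj).trans (h.log_ne j hj)
  frame t := by
    rcases h.frame t with h1 | h1
    · rcases h'.frame t with h2 | h2
      · exact .inl ⟨h2.1.trans h1.1, fun ht => h1.2 (h2.2 ht)⟩
      · exact .inr h2
    · exact .inr h1
  loc := h'.loc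
  term_le := h.term_le.trans h'.term_le
  candidate hz ht := by
    have h1 := h.term_le
    have h2 := h'.term_le
    obtain ⟨h3, h4⟩ := h'.candidate hz (by omega)
    obtain ⟨h5, h6⟩ := h.candidate h3 (by omega)
    exact ⟨h5, h4.trans h6⟩

/-- A step that leaves the history as it is. -/
theorem Local.trans_self {A : View n Op} {s : Fin n} {x x' : Server n Op} (h : Local A s x)
    (ht : x'.currentTerm = x.currentTerm) (hl : x'.log = x.log) (hok : ServerOk A s x')
    (hc : x'.role = .candidate → x.role = .candidate ∧ x'.commitIndex = x.commitIndex) :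
    Trans A s x A x' :=
  ⟨.rfl, fun _ _ => rfl, fun _ _ => rfl, fun _ => .inl ⟨rfl, id⟩,
    ⟨h.inv, h.term_eq.trans ht.symm, h.log_eq.trans hl.symm, hok⟩, ht.ge, fun h _ => hc h⟩

theorem Local.trans_rfl {A : View n Op} {s : Fin n} {x : Server n Op} (h : Local A s x) :
    Trans A s x A x :=
  h.trans_self rfl rfl h.ok fun h => ⟨h, rfl⟩

/-- A server enters a later term. -/
theorem Local.trans_bump {A : View n Op} {s : Fin n} {x x' : Server n Op} (h : Local A s x)
    (ht : x.currentTerm < x'.currentTerm) (hl : x'.log = x.log)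
    (hok : ServerOk (A.bump s x'.currentTerm) s x') :
    Trans A s x (A.bump s x'.currentTerm) x' where
  le := A.le_bump (h.term_eq.trans_le ht.le)
  term_ne j hj := by simp [View.bump, hj]
  log_ne _ _ := rfl
  frame _ := .inl ⟨rfl, id⟩
  loc := ⟨h.inv.bump (h.term_eq.trans_le ht.le), by simp [View.bump], h.log_eq.trans hl.symm, hok⟩
  term_le := ht.le
  candidate _ h := by omega

theorem Local.observe {A : View n Op} {s : Fin n} {x : Server n Op} (h : Local A s x) (t : ℕ) :
    ∃ A', Trans A s x A' (x.observe t) := by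
  unfold Server.observe
  split_ifs with ht
  · refine ⟨_, h.trans_bump (x' := { x with currentTerm := t, role := .follower }) ht rfl ?_⟩
    have hle := A.le_bump (h.term_eq.trans_le ht.le)
    refine ⟨fun u hu hs => (h.ok.owner u hu hs).trans ht.le, fun i hi hc => ?_, nofun, nofun⟩
    obtain ⟨e, h1, h2⟩ := h.ok.commit i hi hc
    exact ⟨e, h1, h2.mono hle⟩
  · exact ⟨A, h.trans_rfl⟩

theorem observe_currentTerm (x : Server n Op) (t : ℕ) :
    (x.observe t).currentTerm = max x.currentTerm t := by
  unfold Server.observe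
  split_ifs <;> simp <;> omega

theorem observe_log (x : Server n Op) (t : ℕ) : (x.observe t).log = x.log := by
  unfold Server.observe
  split_ifs <;> rfl

/-- No step starts a candidacy without raising the term, and `commitIndex` stays fixed while a
candidacy in one term continues. -/
theorem RequestOk.trans {A A' : View n Op} {s : Fin n} {x x' : Server n Op} {t c : ℕ}
    (h : RequestOk x t c) (hT : Trans A s x A' x') : RequestOk x' t c := by
  refine ⟨h.1.trans hT.term_le, fun hc ht => ?_⟩
  have h1 := h.1
  have h2 := hT.term_le
  obtain ⟨h3, h4⟩ := hT.candidate hc (by omega)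
  rw [h4]
  exact h.2 h3 (by omega)

theorem RequestOk.update {A A' : View n Op} {s : Fin n} {srv : Fin n → Server n Op}
    {x' : Server n Op} {t c : ℕ} {j : Fin n} (h : RequestOk (srv j) t c)
    (hT : Trans A s (srv s) A' x') : RequestOk (Function.update srv s x' j) t c := by
  by_cases hj : j = s
  · subst hj
    rw [Function.update_self]
    exact h.trans hT
  · rwa [Function.update_of_ne hj]

theorem MessageOk.trans {A A' : View n Op} {s : Fin n} {srv : Fin n → Server n Op}
    {x' : Server n Op} {m : Message n (Payload Op)} (hB : A.Base) (h : MessageOk A srv m)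
    (hT : Trans A s (srv s) A' x') : MessageOk A' (Function.update srv s x') m := by
  unfold MessageOk at h ⊢
  split <;> rename_i heq <;> simp only [heq] at h
  · exact h.update hT
  · intro hg
    obtain ⟨h1, h2, h3, h4⟩ := h hg
    exact ⟨h1.update hT, h2.trans (hT.le.term _), fun p hp => (h3 p hp).mono hT.le,
      h4.mono hB hT.le h2 subset_rfl⟩
  · obtain ⟨h1, h2, h3⟩ := h
    refine ⟨h1.mono hT.le, h2.imp_right fun h2 i u e hu he hc => ?_, fun i hi hi' hi'' => ?_⟩
    -- The request was complete when it was sent. It stays so because its term is elected, and new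
    -- proposals of earlier terms are then not choosable.
    · obtain ⟨h4, h5⟩ := hB.proposal_of_le hT.le hu h1.1 he hc
      exact h2 i u e hu h4 h5
    · obtain ⟨e, h4, h5⟩ := h3 i hi hi' hi''
      exact ⟨e, entryAt_of_prefix (hT.le.leaderLog _) h4, h5.mono hT.le⟩
  · exact fun hs => (h hs).trans (hT.le.acked _ _)

/-- The residue modulo `n` assigns each term to one server, so a step of `s` cannot touch the leader
logs of the terms of `j`. -/
theorem ServerOk.trans_ne {A A' : View n Op} {s j : Fin n} {x x' y : Server n Op} (hB : A.Base)
    (h : ServerOk A j y) (hT : Trans A s x A' x') (hj : j ≠ s) : ServerOk A' j y := by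
  have hframe : ∀ t, t % n = j →
      A'.leaderLog t = A.leaderLog t ∧ (t ∈ A'.elected → t ∈ A.elected) := fun t ht =>
    (hT.frame t).resolve_right fun hs => hj (Fin.ext (ht.symm.trans hs))
  refine ⟨fun t ht hs => h.owner t ((hframe t hs).2 ht) hs, fun i hi hc => ?_, fun hr => ?_,
    fun hr => ?_⟩
  · obtain ⟨e, h1, h2⟩ := h.commit i hi hc
    exact ⟨e, h1, h2.mono hT.le⟩
  · obtain ⟨h1, h2, h3, h5, h4⟩ := h.leader hr
    exact ⟨h1, hT.le.elected h2, (hframe _ h1).1.trans h3, h5.trans (hT.le.acked _ _), fun k =>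
      ⟨(h4 k).1.trans (hT.le.acked _ _), (h4 k).2⟩⟩
  · obtain ⟨h1, h2, h3, h4⟩ := h.candidate hr
    exact ⟨h1, fun h5 => h2 ((hframe _ h1).2 h5), fun p hp => (h3 p hp).mono hT.le, fun k hk =>
      ⟨(h4 k hk).1.trans (hT.le.term _), (h4 k hk).2.mono hB hT.le (h4 k hk).1 subset_rfl⟩⟩

/-- The invariant of all executions; `h` lists the applications so far. -/
structure Inv (A : View n Op) (h : List (Applied n Op))
    (σ : Global n (Server n Op) (Payload Op)) : Prop where
  loc : ∀ s, Local A s (σ.server s)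
  messages : ∀ m ∈ σ.net, MessageOk A σ.server m
  applied : ∀ a ∈ h, A.Proposal a.index a.entry.term a.entry ∧
    Settled A a.index a.entry.term

theorem Inv.step {A A' : View n Op} {h : List (Applied n Op)}
    {σ : Global n (Server n Op) (Payload Op)} (hI : Inv A h σ) {s : Fin n} {x' : Server n Op}
    {out : Set (Message n (Payload Op))} {ev : Option (Applied n Op)}
    (hT : Trans A s (σ.server s) A' x')
    (hout : ∀ m ∈ out, MessageOk A' (Function.update σ.server s x') m)
    (hev : ∀ a ∈ ev, A'.Proposal a.index a.entry.term a.entry ∧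
      Settled A' a.index a.entry.term) :
    Inv A' (h ++ ev.toList) ⟨Function.update σ.server s x', σ.net ∪ out⟩ := by
  have hB := (hI.loc s).inv.toBase
  refine ⟨fun j => ?_, fun m hm => ?_, fun a ha => ?_⟩
  · by_cases hj : j = s
    · subst hj
      simpa using hT.loc
    · have h1 := hI.loc j
      simp only [Function.update_of_ne hj]
      exact ⟨hT.loc.inv, (hT.term_ne j hj).trans h1.term_eq, (hT.log_ne j hj).trans h1.log_eq,
        h1.ok.trans_ne hB hT hj⟩
  · rcases hm with hm | hm
    · exact (hI.messages m hm).trans hB hT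
    · exact hout m hm
  · rcases List.mem_append.1 ha with ha | ha
    · exact ⟨(hI.applied a ha).1.mono hT.le, (hI.applied a ha).2.mono hT.le⟩
    · exact hev a (by simpa using ha)

/-! ### Paxos: the steps of a single server -/

/-- A leader sends its log from `nextIndex` on. -/
theorem Local.messageOk_append {A : View n Op} {s j : Fin n} {x : Server n Op}
    {srv : Fin n → Server n Op} (hL : Local A s x) (hrole : x.role = .leader)
    {ents : List (Entry Op)}
    (hents : ents = [] ∨ ents = x.log.drop (x.nextIndex j - 1)) :
    MessageOk A srv ⟨s, j, .appendEntries (x.appendArgs j ents)⟩ := by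
  obtain ⟨-, h2, h3, -, h4⟩ := hL.ok.leader hrole
  obtain ⟨-, h5, h6⟩ := h4 j
  have hOk : A.AppendOk (x.appendArgs j ents) := by
    refine View.appendOk_of_leader (k := x.nextIndex j) h2 h5 (by rwa [← h3] at h6) rfl
      (by rw [show (x.appendArgs j ents).term = x.currentTerm from rfl, h3]; rfl) ?_
    change ents <+: (A.leaderLog x.currentTerm).drop (x.nextIndex j - 1)
    rw [h3]
    rcases hents with h | h
    · simp [h]
    · simp [h]
  refine ⟨hOk, hents.imp_right fun h i u e hu he hc => ?_, fun i hi hi' hi'' => ?_⟩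
  · have := hL.inv.complete i u _ e hu h2 he hc
    rw [show (x.appendArgs j ents).term = x.currentTerm from rfl, h3] at this
    simp only [AppendArgs.lastIndex, Server.appendArgs, h, List.length_drop]
    omega
  · obtain ⟨e, he⟩ := hL.ok.commit i hi hi'
    exact ⟨e, by rw [← h3] at he; exact he⟩

theorem Local.act {A : View n Op} {s : Fin n} {srv : Fin n → Server n Op}
    {ev : Option (ℕ × Entry Op)} {x' : Server n Op} {out : Set (Message n (Payload Op))}
    (hL : Local A s (srv s)) (hact : Act s (srv s) ev x' out) :
    ∃ A', Trans A s (srv s) A' x' ∧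
      (∀ m ∈ out, MessageOk A' (Function.update srv s x') m) ∧
      ∀ p ∈ ev, A'.Proposal p.1 p.2.term p.2 ∧ Settled A' p.1 p.2.term := by
  generalize hx : srv s = x at hL hact ⊢
  induction hact with
  | restart =>
    refine ⟨A, hL.trans_self rfl rfl ⟨hL.ok.owner, ?_, nofun, nofun⟩ nofun, nofun, nofun⟩
    intro i hi hi'
    exact absurd hi' (by simpa [boot] using hi.ne')
  | timeout t hrole ht =>
    obtain ⟨hlt, hmod⟩ := ht.1
    refine ⟨_, hL.trans_bump (x' := { x with
      currentTerm := t
      role := .candidate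
      votes := {s}
      entries := indexed x.commitIndex (x.log.drop x.commitIndex) }) hlt rfl
        ⟨fun u hu hs => (hL.ok.owner u hu hs).trans hlt.le, fun i hi hc => ?_, nofun,
          fun _ => ⟨hmod, fun hel => ?_, fun p hp => ?_, fun j hj => ?_⟩⟩, ?_, nofun⟩
    · obtain ⟨e, h1, h2⟩ := hL.ok.commit i hi hc
      exact ⟨e, h1, h2.mono (A.le_bump (hL.term_eq.trans_le hlt.le))⟩
    -- All elected terms of this server are at most its old term, so the new term has had no leader.
    · exact absurd (hL.ok.owner t hel hmod) (by omega)
    · have := hL.inv.proposal_of_mem_indexed (j := s) (c := x.commitIndex) (p := p)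
        (by rwa [hL.log_eq])
      exact this
    · obtain rfl : j = s := by simpa using hj
      refine ⟨by simp [View.bump], ?_⟩
      have := (hL.inv.bump (hL.term_eq.trans_le hlt.le)).reported j t x.commitIndex
      rwa [show (A.bump j t).log j = x.log from hL.log_eq] at this
    · rintro m ⟨j, -, rfl⟩
      simp [MessageOk, RequestOk]
  | becomeLeader log' hrole hvotes hlog =>
    obtain ⟨h1, h2, h3, h4⟩ := hL.ok.candidate hrole
    rw [← hL.log_eq] at hlog
    have hcommit : ∀ i, 0 < i → i ≤ x.commitIndex →
        ∃ e, entryAt (A.log s) i = some e ∧ Settled A i e.term := by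
      rw [hL.log_eq]; exact hL.ok.commit
    have hnil : A.leaderLog x.currentTerm <+: log' := by
      rw [hL.inv.leaderLog_eq_nil _ h2]; exact List.nil_prefix
    have hle := View.le_lead hL.inv.toBase hL.term_eq hnil
    refine ⟨A.lead s x.currentTerm log', ⟨hle, fun _ _ => rfl, fun j hj => by
      simp [View.lead, hj], fun t => ?_, ⟨hL.inv.elect hL.term_eq h2 hcommit h3 hvotes h4 hlog,
        hL.term_eq, by simp [View.lead], ⟨fun t ht hs => ?_, fun i hi hc => ?_, fun _ => ?_,
          nofun⟩⟩, le_rfl, nofun⟩, nofun, nofun⟩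
    · by_cases ht : t = x.currentTerm
      · exact .inr (ht ▸ h1)
      · exact .inl (by simp [View.lead, ht])
    · rcases ht with rfl | ht
      exacts [le_rfl, hL.ok.owner t ht hs]
    · obtain ⟨e, h5, h6⟩ := hcommit i hi hc
      exact ⟨e, (hlog.1 i hc).trans h5, h6.mono hle⟩
    · refine ⟨h1, .inl rfl, by simp [View.lead], by simp [View.lead],
        fun j => ⟨Nat.zero_le _, by simp, ?_⟩⟩
      -- The initial `nextIndex` is at most one past the end of the new log, because the entry at
      -- the commit index is retained.
      rcases Nat.eq_zero_or_pos x.commitIndex with h0 | h0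
      · simp [h0]
      · obtain ⟨e, h5, -⟩ := hcommit _ h0 le_rfl
        rw [← hlog.1 _ le_rfl] at h5
        exact Nat.succ_le_succ (entryAt_le_length h5)
  | clientRequest op hrole =>
    obtain ⟨h1, h2, h3, hself, h4⟩ := hL.ok.leader hrole
    have hpre := List.prefix_append (A.leaderLog x.currentTerm) [⟨op, x.currentTerm⟩]
    have hle := View.le_lead hL.inv.toBase hL.term_eq hpre
    have hinv := hL.inv.concat (a := ⟨op, x.currentTerm⟩) hL.term_eq h2 rfl
    rw [h3] at hle hinv hpre
    refine ⟨A.lead s x.currentTerm (x.log ++ [⟨op, x.currentTerm⟩]), ⟨hle, fun _ _ => rfl,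
      fun j hj => by simp [View.lead, hj], fun t => ?_, ⟨hinv, hL.term_eq, by simp [View.lead],
        ⟨fun t ht hs => ?_, fun i hi hc => ?_, fun _ => ⟨h1, .inl rfl, by simp [View.lead],
          by simp [View.lead], fun j => ?_⟩, fun hr => ?_⟩⟩, le_rfl, fun hr => ?_⟩, nofun, nofun⟩
    · by_cases ht : t = x.currentTerm
      · exact .inr (ht ▸ h1)
      · exact .inl (by simp [View.lead, ht])
    · rcases ht with rfl | ht
      exacts [le_rfl, hL.ok.owner t ht hs]
    · obtain ⟨e, h5, h6⟩ := hL.ok.commit i hi hc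
      exact ⟨e, entryAt_of_prefix hpre h5, h6.mono hle⟩
    · obtain ⟨h5, h6, h7⟩ := h4 j
      refine ⟨h5.trans (hle.acked _ _), h6, ?_⟩
      simp only [List.length_append]
      omega
    · rw [hrole] at hr; cases hr
    · rw [hrole] at hr; cases hr
  | replicate j hj hrole hnext =>
    refine ⟨A, hL.trans_rfl, ?_, nofun⟩
    rintro m rfl
    exact hL.messageOk_append hrole (.inr rfl)
  | heartbeat j hj hrole =>
    refine ⟨A, hL.trans_rfl, ?_, nofun⟩
    rintro m rfl
    exact hL.messageOk_append hrole (.inl rfl)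
  | advanceCommit N hrole hN hlen hmaj =>
    obtain ⟨h1, h2, h3, hself, h4⟩ := hL.ok.leader hrole
    have hr : x.role ≠ .candidate := by rw [hrole]; nofun
    refine ⟨A, hL.trans_self rfl rfl ⟨hL.ok.owner, fun i hi hc => ?_, hL.ok.leader,
      fun h => absurd h hr⟩ fun h => absurd h hr, nofun, nofun⟩
    obtain ⟨e, he⟩ := exists_entryAt hi (hc.trans hlen)
    refine ⟨e, he, ?_⟩
    rw [← h3] at he
    -- No condition on the entry's term is needed: an entry of the current term becomes chosen
    -- through this majority, and an inherited one was settled before.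
    rcases hL.inv.settled _ i e he with h | h
    · refine ⟨e.term, le_rfl, ⟨_, hmaj, fun j hj => ?_⟩, e, by rw [h]; exact ⟨he, h⟩⟩
      rw [h]
      rcases (Finset.mem_filter.1 hj).2 with rfl | hj
      · exact (hc.trans hlen).trans hself
      · exact (hc.trans hj).trans (h4 j).1
    · exact h
  | apply e hlt he =>
    refine ⟨A, hL.trans_self rfl rfl ⟨hL.ok.owner, hL.ok.commit, hL.ok.leader, hL.ok.candidate⟩
      fun h => ⟨h, rfl⟩, nofun, ?_⟩
    rintro _ ⟨⟩
    obtain ⟨e', he', hs⟩ := hL.ok.commit _ (Nat.succ_pos _) hlt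
    cases he.symm.trans he'
    exact ⟨(hL.log_eq ▸ hL.inv.genuine s).proposal he, hs⟩

theorem Local.receive_requestVote {A : View n Op} {s : Fin n} {srv : Fin n → Server n Op}
    (hL : Local A s (srv s)) {m : Message n (Payload Op)} {t c : ℕ}
    (hp : m.payload = .requestVote t c) (hm : MessageOk A srv m) :
    ∃ A', Trans A s (srv s) A' (receive s (srv s) m).1 ∧
      ∀ m' ∈ (receive s (srv s) m).2,
        MessageOk A' (Function.update srv s (receive s (srv s) m).1) m' := by
  simp only [MessageOk, hp] at hm
  simp only [receive, hp]
  split_ifs with h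
  · refine ⟨A, hL.trans_rfl, ?_⟩
    rintro m' rfl
    exact nofun
  · obtain ⟨A', hT⟩ := hL.observe t
    refine ⟨A', hT, ?_⟩
    rintro m' rfl
    intro _
    have hlog : A'.log s = (srv s).log := hT.loc.log_eq.trans (observe_log _ _)
    refine ⟨hm.update hT, ?_, fun p hp => ?_, ?_⟩
    · rw [hT.loc.term_eq, observe_currentTerm]
      exact le_max_right _ _
    · rw [← hlog] at hp
      exact hT.loc.inv.proposal_of_mem_indexed hp
    · rw [← hlog]
      exact hT.loc.inv.reported s t c

theorem Local.receive_voteReply {A : View n Op} {s : Fin n} {srv : Fin n → Server n Op}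
    (hL : Local A s (srv s)) {m : Message n (Payload Op)} {r c t : ℕ} {g : Bool}
    {ents : List (Entry Op)} (hs : m.dst = s)
    (hp : m.payload = .voteReply r c t g ents) (hm : MessageOk A srv m) :
    ∃ A', Trans A s (srv s) A' (receive s (srv s) m).1 ∧
      ∀ m' ∈ (receive s (srv s) m).2,
        MessageOk A' (Function.update srv s (receive s (srv s) m).1) m' := by
  simp only [receive, hp]
  obtain ⟨A', hT⟩ := hL.observe t
  have hm' := hm.trans hL.inv.toBase hT
  simp only [MessageOk, hp, hs, Function.update_self] at hm'
  have hL' := hT.loc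
  generalize (srv s).observe t = y at hT hL' hm' ⊢
  split_ifs with h
  · obtain ⟨hc, hr, -, hg⟩ := h
    obtain ⟨h1, h2, h3, h4⟩ := hm' hg
    obtain ⟨h5, h6, h7, h8⟩ := hL'.ok.candidate hc
    -- The reply starts after the commit index named in the request, which is still that of the
    -- candidate.
    have hci := h1.2 hc hr.symm
    subst hr
    refine ⟨A', hT.trans (hL'.trans_self rfl rfl ⟨hL'.ok.owner, hL'.ok.commit, hL'.ok.leader,
      fun _ => ⟨h5, h6, fun p hp => hp.elim (h7 p) (h3 p), fun j hj => ?_⟩⟩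
      fun h => ⟨h, rfl⟩), nofun⟩
    rcases Finset.mem_insert.1 hj with rfl | hj
    · refine ⟨h2, ?_⟩
      dsimp only
      rw [hci]
      exact h4.mono hL'.inv.toBase .rfl h2 Set.subset_union_right
    · exact ⟨(h8 j hj).1, (h8 j hj).2.mono hL'.inv.toBase .rfl (h8 j hj).1
        Set.subset_union_left⟩
  · exact ⟨A', hT, nofun⟩

theorem Local.receive_appendEntries {A : View n Op} {s : Fin n} {srv : Fin n → Server n Op}
    (hL : Local A s (srv s)) {m : Message n (Payload Op)} {a : AppendArgs Op}
    (hp : m.payload = .appendEntries a) (hm : MessageOk A srv m) :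
    ∃ A', Trans A s (srv s) A' (receive s (srv s) m).1 ∧
      ∀ m' ∈ (receive s (srv s) m).2,
        MessageOk A' (Function.update srv s (receive s (srv s) m).1) m' := by
  simp only [receive, hp]
  split_ifs with hlt hmatch
  · refine ⟨A, hL.trans_rfl, ?_⟩
    rintro m' rfl
    exact nofun
  · obtain ⟨A', hT⟩ := hL.observe a.term
    have hm' := hm.trans hL.inv.toBase hT
    have hterm : ((srv s).observe a.term).currentTerm = a.term := by
      rw [observe_currentTerm]; omega
    simp only [MessageOk, hp] at hm'
    have hL' := hT.loc
    generalize (srv s).observe a.term = y at hT hL' hm' hterm hmatch ⊢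
    obtain ⟨⟨hel, p, hlen, hpre, hv⟩, hfull, hcommit⟩ := hm'
    have hlast : a.lastIndex = (p ++ a.entries).length := by
      rw [List.length_append, hlen]; rfl
    rw [← hlen] at hmatch
    have hgen : A'.Genuine y.log := hL'.log_eq ▸ hL'.inv.genuine s
    have hstore := hgen.store_eq ((hL'.inv.genuine_leader _).of_prefix hpre) hmatch hv
    have hts : A'.term s ≤ a.term := (hL'.term_eq.trans hterm).le
    -- A heartbeat that passes the check leaves the log as it is, so its segment was already
    -- present.
    have hfull' : p ++ a.entries <+: A'.log s ∨ ∀ i u e, u < a.term → A'.Proposal i u e →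
        A'.Choosable i u → i ≤ (p ++ a.entries).length := by
      rw [← hlast]
      refine hfull.imp_left fun h => ?_
      have : store y.log p.length a.entries = y.log := by
        have hnil : ∀ l : List (Entry Op), overwrite l [] = l := fun l => by cases l <;> rfl
        rw [h, store, hnil, List.take_append_drop]
      rw [hstore] at this
      rw [hL'.log_eq, ← this]
      exact prefix_merge _ _
    rw [hlen] at hstore
    have hle := A'.le_accept (p := p ++ a.entries) hts
    refine ⟨A'.accept s a.term (p ++ a.entries), hT.trans ⟨hle, fun j hj => by
      simp [View.accept, hj], fun j hj => by simp [View.accept, hj], fun _ => .inl ⟨rfl, id⟩,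
      ⟨hL'.inv.accept hts hpre hfull', by simp [View.accept, hterm], by
        simp [View.accept, hstore, hL'.log_eq], ⟨hL'.ok.owner, fun i hi hc => ?_, fun hr => ?_,
          fun hr => ?_⟩⟩, le_rfl, fun hr => ?_⟩, ?_⟩
    · suffices h : ∃ e, entryAt (store y.log a.prevLogIndex a.entries) i = some e ∧
          Settled A' i e.term from
        let ⟨e, h1, h2⟩ := h
        ⟨e, h1, h2.mono hle⟩
      rw [hstore, ← hL'.log_eq]
      dsimp only at hc
      rcases le_max_iff.1 hc with hc | hc
      · obtain ⟨e, h1, h2⟩ := hL'.ok.commit i hi hc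
        rw [← hL'.log_eq] at h1
        exact hL'.inv.merge_of_settled hts hpre hfull' h1 h2
      · obtain ⟨hc1, hc2⟩ := le_min_iff.1 hc
        obtain ⟨e, h1, h2⟩ := hcommit i hi hc1 hc2
        refine ⟨e, entryAt_of_prefix (prefix_merge _ _) ?_, h2⟩
        rw [← entryAt_prefix hpre (by omega)]
        exact h1
    -- A leader that receives a request of its own term already holds these entries, so storing them
    -- changes nothing.
    · obtain ⟨h1, h2, h3, h4, h5⟩ := hL'.ok.leader hr
      dsimp only
      rw [hstore, merge_of_prefix (by rw [← h3, hterm]; exact hpre)]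
      exact ⟨h1, h2, h3, h4.trans (hle.acked _ _), fun j =>
        ⟨(h5 j).1.trans (hle.acked _ _), (h5 j).2⟩⟩
    -- The request belongs to an elected term, but the term of a candidate is not elected.
    · exact absurd (hterm ▸ hel) (hL'.ok.candidate hr).2.1
    · exact absurd (hterm ▸ hel) (hL'.ok.candidate hr).2.1
    · rintro m' rfl
      intro _
      simp [View.accept, hlast]
  · obtain ⟨A', hT⟩ := hL.observe a.term
    refine ⟨A', hT, ?_⟩
    rintro m' rfl
    exact nofun

theorem Local.receive_appendReply {A : View n Op} {s : Fin n} {srv : Fin n → Server n Op}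
    (hL : Local A s (srv s)) {m : Message n (Payload Op)} {a : AppendArgs Op} {t : ℕ} {b : Bool}
    (hp : m.payload = .appendReply a t b) (hm : MessageOk A srv m) :
    ∃ A', Trans A s (srv s) A' (receive s (srv s) m).1 ∧
      ∀ m' ∈ (receive s (srv s) m).2,
        MessageOk A' (Function.update srv s (receive s (srv s) m).1) m' := by
  simp only [receive, hp]
  obtain ⟨A', hT⟩ := hL.observe t
  have hm' := hm.trans hL.inv.toBase hT
  simp only [MessageOk, hp] at hm'
  have hL' := hT.loc
  generalize (srv s).observe t = y at hT hL' hm' ⊢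
  split_ifs with h hb
  · obtain ⟨hr, ha, -⟩ := h
    obtain ⟨h1, h2, h3, h4, h5⟩ := hL'.ok.leader hr
    have h6 := hm' hb
    rw [ha] at h6
    -- Acknowledged indices lie within the leader's log, which bounds the new `nextIndex`.
    have h7 := hL'.inv.acked_le m.src y.currentTerm
    rw [h3] at h7
    refine ⟨A', hT.trans (hL'.trans_self rfl rfl ⟨hL'.ok.owner, hL'.ok.commit, fun _ =>
      ⟨h1, h2, h3, h4, fun j => ?_⟩, hL'.ok.candidate⟩ fun h => ⟨h, rfl⟩), nofun⟩
    by_cases hj : j = m.src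
    · subst hj
      have h8 := (h5 m.src).1
      simp only [Function.update_self]
      omega
    · simpa [hj] using h5 j
  · obtain ⟨hr, ha, -⟩ := h
    obtain ⟨h1, h2, h3, h4, h5⟩ := hL'.ok.leader hr
    refine ⟨A', hT.trans (hL'.trans_self rfl rfl ⟨hL'.ok.owner, hL'.ok.commit, fun _ =>
      ⟨h1, h2, h3, h4, fun j => ?_⟩, hL'.ok.candidate⟩ fun h => ⟨h, rfl⟩), nofun⟩
    by_cases hj : j = m.src
    · subst hj
      have h8 := h5 m.src
      simp only [Function.update_self]
      omega
    · simpa [hj] using h5 j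
  · exact ⟨A', hT, nofun⟩

theorem Local.receive {A : View n Op} {s : Fin n} {srv : Fin n → Server n Op}
    (hL : Local A s (srv s)) {m : Message n (Payload Op)} (hs : m.dst = s)
    (hm : MessageOk A srv m) :
    ∃ A', Trans A s (srv s) A' (receive s (srv s) m).1 ∧
      ∀ m' ∈ (Paxos.receive s (srv s) m).2,
        MessageOk A' (Function.update srv s (Paxos.receive s (srv s) m).1) m' := by
  cases hp : m.payload with
  | requestVote t c => exact hL.receive_requestVote hp hm
  | voteReply r c t g ents => exact hL.receive_voteReply hs hp hm
  | appendEntries a => exact hL.receive_appendEntries hp hm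
  | appendReply a t b => exact hL.receive_appendReply hp hm

/-! ### Paxos: executions -/

theorem exists_inv_init : ∃ A : View n Op, Inv A [] ⟨fun _ => boot 0 [], ∅⟩ := by
  refine ⟨⟨fun _ => 0, fun _ => [], fun _ => [], ∅, fun _ _ => 0⟩, fun s => ⟨⟨⟨?_, ?_, ?_, ?_,
    ?_, ?_, ?_, ?_⟩, ?_, ?_, ?_, ?_⟩, rfl, rfl, ⟨?_, ?_, nofun, nofun⟩⟩, nofun, nofun⟩ <;>
    simp [View.Genuine, View.Proposal, entryAt, boot]
  omega

theorem exists_inv {h : List (Applied n Op)} {σ : Global n (Server n Op) (Payload Op)}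
    (hrun : Run (protocol n Op) h σ) : ∃ A, Inv A h σ := by
  induction hrun with
  | init => exact exists_inv_init
  | step h σ ev σ' _ hstep ih =>
    obtain ⟨A, hI⟩ := ih
    cases hstep with
    | act s ev x' out hact =>
      obtain ⟨A', hT, hout, hev⟩ := (hI.loc s).act hact
      refine ⟨A', hI.step hT hout fun a ha => ?_⟩
      obtain ⟨p, hp, rfl⟩ := Option.map_eq_some_iff.1 ha
      exact hev p hp
    | deliver m hm =>
      obtain ⟨A', hT, hout⟩ := (hI.loc m.dst).receive rfl (hI.messages m hm)
      exact ⟨A', hI.step (ev := none) hT hout nofun⟩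

/-- State machine safety for Paxos. -/
theorem op_eq_of_applied {h : List (Applied n Op)} {σ : Global n (Server n Op) (Payload Op)}
    (hrun : Run (protocol n Op) h σ) {s s' : Fin n} {i : ℕ} {e e' : Entry Op}
    (he : ⟨s, i, e⟩ ∈ h) (he' : ⟨s', i, e'⟩ ∈ h) : e.op = e'.op := by
  obtain ⟨A, hI⟩ := exists_inv hrun
  obtain ⟨h1, h2⟩ := hI.applied _ he
  obtain ⟨h3, h4⟩ := hI.applied _ he'
  exact (hI.loc s).inv.op_eq_of_settled h1 h3 h2 h4

end Consensus.Paxos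

namespace Consensus.Raft

variable {n : ℕ} {Op : Type*}

/-! ### Raft: safety of the logs -/

/-- Logs that may still become committed are initial segments of the logs of all later leaders. -/
structure LogInv (A : View n Op) : Prop extends A.Base where
  complete : ∀ N u t e, u < t → t ∈ A.elected → A.Proposal N u e → A.Choosable N u →
    (A.leaderLog u).take N <+: A.leaderLog t
  stored : ∀ j N u e, A.Proposal N u e → N ≤ A.acked j u → A.Choosable N u →
    (A.leaderLog u).take N <+: A.log j
  sorted : ∀ t i k e e', i ≤ k → entryAt (A.leaderLog t) i = some e →
    entryAt (A.leaderLog t) k = some e' → e.term ≤ e'.term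

/-- As prefixes of `r`, the lists `p` and `q` are comparable. If `p` is the shorter one, it is
already a prefix of `l` and nothing is deleted. -/
theorem prefix_merge_of_prefix {l p q r : List (Entry Op)} (hql : q <+: l) (hqr : q <+: r)
    (hpr : p <+: r) : q <+: merge l p := by
  by_cases h : p <+: l
  · rwa [merge_of_prefix h]
  · rw [merge_of_not_prefix h]
    rcases List.prefix_or_prefix_of_prefix hqr hpr with h' | h'
    · exact h'
    · exact absurd (h'.trans hql) h

namespace LogInv

theorem bump {A : View n Op} (hA : LogInv A) {s : Fin n} {t : ℕ} (ht : A.term s ≤ t) :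
    LogInv (A.bump s t) :=
  have hle := A.le_bump ht
  ⟨hA.toBase.bump ht, fun N u v e huv hv he hc => hA.complete N u v e huv hv he (hc.anti hle),
    fun j N u e he hN hc => hA.stored j N u e he hN (hc.anti hle), hA.sorted⟩

/-- Unlike in Paxos, partial requests are harmless: a segment still choosable in a term up to `t`
and the segment `p` are prefixes of the same leader log, so storing `p` cannot cut the former off.
-/
theorem accept {A : View n Op} (hA : LogInv A) {s : Fin n} {t : ℕ} {p : List (Entry Op)}
    (ht : A.term s ≤ t) (hel : t ∈ A.elected) (hp : p <+: A.leaderLog t) :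
    LogInv (A.accept s t p) := by
  have hle := A.le_accept (p := p) ht
  refine ⟨hA.toBase.accept ht hp, fun N u v e huv hv he hc =>
    hA.complete N u v e huv hv he (hc.anti hle), fun j N u e he hN hc => ?_, hA.sorted⟩
  replace he : A.Proposal N u e := he
  replace hc := hc.anti hle
  change (A.leaderLog u).take N <+: _
  by_cases hj : j = s
  · subst hj
    simp only [View.accept, Function.update_self] at hN ⊢
    by_cases h1 : u = t ∧ N ≤ p.length
    · obtain ⟨rfl, h1⟩ := h1
      rw [take_eq_of_prefix hp h1]
      exact (List.take_prefix _ _).trans (prefix_merge _ _)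
    · have hN' : N ≤ A.acked j u := by
        by_cases hu : u = t
        · subst hu
          simp only [Function.update_self, le_max_iff] at hN
          exact hN.resolve_right fun h => h1 ⟨rfl, h⟩
        · simpa [hu] using hN
      refine prefix_merge_of_prefix (hA.stored j N u e he hN' hc) ?_ hp
      have hut : u ≤ t := (hA.le_term j u ((entryAt_pos he.1).trans_le hN')).trans ht
      rcases hut.eq_or_lt with rfl | hut
      · exact List.take_prefix _ _
      · exact hA.complete N u t e hut hel he hc
  · simp only [View.accept, ne_eq, hj, not_false_eq_true, Function.update_of_ne] at hN ⊢
    exact hA.stored j N u e he hN hc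

theorem lead {A : View n Op} (hA : LogInv A) {s : Fin n} {t : ℕ} {l : List (Entry Op)}
    (hB : (A.lead s t l).Base) (ht : A.term s = t) (hl : A.leaderLog t <+: l)
    (hlog : A.log s <+: l)
    (hcomplete : ∀ N u e, u < t → A.Proposal N u e → A.Choosable N u →
      (A.leaderLog u).take N <+: l)
    (hsorted : ∀ i k e e', i ≤ k → entryAt l i = some e → entryAt l k = some e' →
      e.term ≤ e'.term) :
    LogInv (A.lead s t l) := by
  have hle := View.le_lead hA.toBase ht hl
  have hself : (A.lead s t l).leaderLog t = l := by simp [View.lead]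
  have hne : ∀ u, u ≠ t → (A.lead s t l).leaderLog u = A.leaderLog u := fun u hu => by
    simp [View.lead, hu]
  refine ⟨hB, fun N u v e huv hv he hc => ?_, fun j N u e he hN hc => ?_,
    fun v i k e e' hik he he' => ?_⟩
  · by_cases hv' : v = t
    · subst hv'
      rw [View.Proposal, hne u (by omega)] at he
      rw [hself, hne u (by omega)]
      exact hcomplete N u e huv he (hc.anti hle)
    · have hv : v ∈ A.elected := hv.resolve_left hv'
      obtain ⟨h1, h2⟩ := hA.proposal_of_le hle huv hv he hc
      rw [hne v hv', take_eq_of_prefix (hle.leaderLog u) (entryAt_le_length h1.1)]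
      exact hA.complete N u v e huv hv h1 h2
  · have hold : N ≤ A.acked j u → ((A.lead s t l).leaderLog u).take N <+: A.log j := by
      intro hN'
      have h1 := hA.proposal_of_acked hle hN' he
      rw [take_eq_of_prefix (hle.leaderLog u) (entryAt_le_length h1.1)]
      exact hA.stored j N u e h1 hN' (hc.anti hle)
    -- Earlier acknowledgements of the leader survive because its old log is a prefix of `l`.
    by_cases hj : j = s
    · subst hj
      have hlog' : (A.lead j t l).log j = l := by simp [View.lead]
      rw [hlog']
      by_cases hu : u = t
      · rw [hu, hself]
        exact List.take_prefix _ _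
      · exact (hold (by simpa [View.lead, hu] using hN)).trans hlog
    · have hlog' : (A.lead s t l).log j = A.log j := by simp [View.lead, hj]
      rw [hlog']
      exact hold (by simpa [View.lead, hj] using hN)
  · by_cases hv : v = t
    · rw [hv, hself] at he he'
      exact hsorted i k e e' hik he he'
    · rw [hne v hv] at he he'
      exact hA.sorted v i k e e' hik he he'

theorem concat {A : View n Op} (hA : LogInv A) {s : Fin n} {t : ℕ} {a : Entry Op}
    (ht : A.term s = t) (hel : t ∈ A.elected) (hlog : A.log s = A.leaderLog t)
    (ha : a.term = t) : LogInv (A.lead s t (A.leaderLog t ++ [a])) := by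
  have hpre := List.prefix_append (A.leaderLog t) [a]
  refine hA.lead (hA.toBase.lead ht hpre (hA.quorum t hel) fun i e he =>
    hA.entry_concat ha he) ht hpre (hlog ▸ hpre) (fun N u e hu he hc =>
    (hA.complete N u t e hu hel he hc).trans hpre) (fun i k e e' hik he he' => ?_)
  have hle : e.term ≤ t := by
    rcases entryAt_concat he with h | ⟨-, rfl⟩
    exacts [hA.entry_le_leader t i e h, ha.le]
  rcases entryAt_concat he' with h' | ⟨-, rfl⟩
  · rw [entryAt_prefix hpre (hik.trans (entryAt_le_length h'))] at he
    exact hA.sorted t i k e e' hik he h'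
  · omega

end LogInv

/-! ### Raft: elections -/

/-- A log with last index `li` and last term `lt` is at least as up-to-date as what server `j`
acknowledged before term `t`. -/
def Fresh (A : View n Op) (j : Fin n) (t li lt : ℕ) : Prop :=
  ∀ N u e, u < t → A.Proposal N u e → N ≤ A.acked j u → A.Choosable N u →
    u < lt ∨ (u = lt ∧ N ≤ li)

theorem Fresh.mono {A A' : View n Op} (hB : A.Base) (hA : A.Le A') {j : Fin n} {t li lt : ℕ}
    (h : Fresh A j t li lt) (ht : t ≤ A.term j) : Fresh A' j t li lt := by
  intro N u e hu he hN hc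
  rw [hA.acked_eq j u (by omega)] at hN
  exact h N u e hu (hB.proposal_of_acked hA hN he) hN (hc.anti hA)

/-- A nonempty log is an initial segment of the log of the leader of its last term. -/
theorem exists_last {A : View n Op} {l : List (Entry Op)} (hl : A.Genuine l)
    (h0 : 0 < l.length) :
    ∃ e, entryAt l l.length = some e ∧ termAt l l.length = e.term ∧
      l <+: A.leaderLog e.term := by
  obtain ⟨e, he⟩ := exists_entryAt h0 le_rfl
  have := hl _ e he
  rw [List.take_length] at this
  exact ⟨e, he, by simp [termAt, he], this⟩

/-- The voter's log contains the acknowledged segment, and terms do not decrease along it. Its last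
entry thus has term at least `u` and index at least `N`, and the candidate's last entry compares at
least as well. -/
theorem LogInv.fresh {A : View n Op} (hA : LogInv A) {j : Fin n} {t li lt : ℕ}
    (h : UpToDate li lt (A.log j)) : Fresh A j t li lt := by
  intro N u e hu he hN hc
  have h1 := hA.stored j N u e he hN hc
  have h2 : entryAt (A.log j) N = some e :=
    entryAt_of_prefix h1 (by rw [entryAt_take le_rfl]; exact he.1)
  have h3 := entryAt_le_length h2
  obtain ⟨a, ha, hterm, hpre⟩ := exists_last (hA.genuine j) ((entryAt_pos h2).trans_le h3)
  have h4 := hA.sorted a.term N _ e a h3 (entryAt_of_prefix hpre h2) (entryAt_of_prefix hpre ha)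
  rw [he.2] at h4
  unfold UpToDate at h
  omega

/-- The heart of Raft. A common member of the voting majority and of the choosability majority shows
that the candidate is at least as up-to-date as the choosable segment. Both are then prefixes of the
log of the leader of the candidate's last term, and comparing lengths finishes the argument. -/
theorem LogInv.elect {A : View n Op} (hA : LogInv A) {s : Fin n} {t : ℕ} {Q : Finset (Fin n)}
    (ht : A.term s = t) (hel : t ∉ A.elected) (hQ : IsMajority Q)
    (hvotes : ∀ j ∈ Q, t ≤ A.term j ∧
      Fresh A j t (A.log s).length (termAt (A.log s) (A.log s).length)) :
    LogInv (A.lead s t (A.log s)) := by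
  have hnil : A.leaderLog t <+: A.log s := by
    rw [hA.leaderLog_eq_nil t hel]; exact List.nil_prefix
  refine hA.lead (hA.toBase.lead ht hnil ⟨Q, hQ, fun j hj => (hvotes j hj).1⟩ fun i e he => ?_)
    ht hnil List.prefix_rfl (fun N u e hu he hc => ?_) fun i k e e' hik he he' => ?_
  · have h1 := hA.entry_le s i e he
    have h2 : e.term ≠ t := fun h =>
      hel (h ▸ hA.elected_of_entryAt ((hA.genuine s).proposal he).1)
    exact .inr ⟨by omega, hA.genuine s i e he⟩
  · have hfresh : u < termAt (A.log s) (A.log s).length ∨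
        (u = termAt (A.log s) (A.log s).length ∧ N ≤ (A.log s).length) := by
      obtain ⟨R, hR, hRc⟩ := hc
      obtain ⟨j, hjQ, hjR⟩ := hQ.exists_common hR
      obtain ⟨h1, h2⟩ := hvotes j hjQ
      refine h2 N u e hu he ?_ ⟨R, hR, hRc⟩
      rcases hRc j hjR with h | h
      · exact h
      · omega
    have hN := entryAt_pos he.1
    -- An empty log has last index and last term `0`, which can beat no acknowledged entry.
    have h0 : 0 < (A.log s).length := by
      by_contra! h0
      rw [List.length_eq_zero_iff.1 (Nat.le_zero.1 h0)] at hfresh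
      simp [termAt, entryAt] at hfresh
      omega
    obtain ⟨a, ha, hterm, hpre⟩ := exists_last (hA.genuine s) h0
    have ha' := entryAt_of_prefix hpre ha
    rw [hterm] at hfresh
    rcases hfresh with h | ⟨rfl, h⟩
    · have h1 := hA.complete N u a.term e h (hA.elected_of_entryAt ha') he hc
      refine List.prefix_of_prefix_length_le h1 hpre ?_
      rw [List.length_take]
      -- If the candidate's log ended before `N`, monotonicity of terms would give `a.term ≤ u`.
      by_contra! hlt
      have h2 := entryAt_of_prefix h1 (by rw [entryAt_take le_rfl]; exact he.1)
      have h3 := hA.sorted a.term _ N a e (by omega) ha' h2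
      have := he.2
      omega
    · refine List.prefix_of_prefix_length_le (List.take_prefix _ _) hpre ?_
      rw [List.length_take]
      omega
  · obtain ⟨a, ha, hterm, hpre⟩ := exists_last (hA.genuine s)
      ((entryAt_pos he).trans_le (entryAt_le_length he))
    exact hA.sorted a.term i k e e' hik (entryAt_of_prefix hpre he) (entryAt_of_prefix hpre he')

/-! ### Raft: committed segments -/

/-- The log `l` agrees up to index `c` with the log of a leader of a term up to `b` who knew that
a majority stores it. -/
def Committed (A : View n Op) (b : ℕ) (l : List (Entry Op)) (c : ℕ) : Prop :=
  c = 0 ∨ ∃ N u e, c ≤ N ∧ u ≤ b ∧ A.Proposal N u e ∧ A.Chosen N u ∧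
    (A.leaderLog u).take c <+: l

theorem Committed.mono {A A' : View n Op} (hA : A.Le A') {b b' c c' : ℕ}
    {l l' : List (Entry Op)} (h : Committed A b l c) (hb : b ≤ b') (hc : c' ≤ c)
    (hl : l <+: l') : Committed A' b' l' c' := by
  rcases h with rfl | ⟨N, u, e, h1, h2, h3, h4, h5⟩
  · exact .inl (by omega)
  · have h6 := entryAt_le_length h3.1
    refine .inr ⟨N, u, e, hc.trans h1, h2.trans hb, h3.mono hA, h4.mono hA, ?_⟩
    rw [take_eq_of_prefix (hA.leaderLog u) (by omega)]
    exact ((List.take_prefix_take_left hc).trans h5).trans hl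

theorem Committed.prefix_of_le {A : View n Op} {b c : ℕ} {l p : List (Entry Op)}
    (h : Committed A b l c) (hp : p <+: l) (hc : c ≤ p.length) : Committed A b p c := by
  rcases h with rfl | ⟨N, u, e, h1, h2, h3, h4, h5⟩
  · exact .inl rfl
  · refine .inr ⟨N, u, e, h1, h2, h3, h4, List.prefix_of_prefix_length_le h5 hp ?_⟩
    rw [List.length_take]
    omega

/-- The bound on `u` in `Committed` is used here: a segment chosen in a term up to `t` is a prefix
of the leader log of `t`, so a request of that leader cannot delete it. -/
theorem LogInv.committed_merge {A : View n Op} (hA : LogInv A) {b t c : ℕ}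
    {l p : List (Entry Op)} (h : Committed A b l c) (hb : b ≤ t) (hel : t ∈ A.elected)
    (hp : p <+: A.leaderLog t) : Committed A t (merge l p) c := by
  rcases h with rfl | ⟨N, u, e, h1, h2, h3, h4, h5⟩
  · exact .inl rfl
  · refine .inr ⟨N, u, e, h1, h2.trans hb, h3, h4, prefix_merge_of_prefix h5 ?_ hp⟩
    rcases (h2.trans hb).eq_or_lt with rfl | hut
    · exact List.take_prefix _ _
    · exact (List.take_prefix_take_left h1).trans
        (hA.complete N u t e hut hel h3 h4.choosable)

/-- The entry `e` at index `i` is committed. -/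
def Final (A : View n Op) (i : ℕ) (e : Entry Op) : Prop :=
  ∃ N u e₀, i ≤ N ∧ A.Proposal N u e₀ ∧ A.Chosen N u ∧ entryAt (A.leaderLog u) i = some e

theorem Final.mono {A A' : View n Op} (hA : A.Le A') {i : ℕ} {e : Entry Op}
    (h : Final A i e) : Final A' i e :=
  let ⟨N, u, e₀, h1, h2, h3, h4⟩ := h
  ⟨N, u, e₀, h1, h2.mono hA, h3.mono hA, entryAt_of_prefix (hA.leaderLog u) h4⟩

theorem Committed.final {A : View n Op} {b c i : ℕ} {l : List (Entry Op)} {e : Entry Op}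
    (h : Committed A b l c) (hi : i ≤ c) (he : entryAt l i = some e) : Final A i e := by
  have h0 := entryAt_pos he
  rcases h with rfl | ⟨N, u, e₀, h1, h2, h3, h4, h5⟩
  · omega
  · refine ⟨N, u, e₀, hi.trans h1, h3, h4, ?_⟩
    have h6 := entryAt_le_length h3.1
    rwa [entryAt_prefix h5 (by rw [List.length_take]; omega), entryAt_take hi] at he

/-- Chosen segments are choosable, so the segment of the earlier leader is a prefix of the later
leader's log, and both entries at index `i` are read from it. -/
theorem LogInv.eq_of_final {A : View n Op} (hA : LogInv A) {i : ℕ} {e e' : Entry Op}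
    (h : Final A i e) (h' : Final A i e') : e = e' := by
  have key : ∀ N u e₀ e₁ u', i ≤ N → A.Proposal N u e₀ → A.Chosen N u → u < u' →
      entryAt (A.leaderLog u') i = some e₁ → entryAt (A.leaderLog u) i = some e₁ := by
    intro N u e₀ e₁ u' hi hp hc hu he
    have h1 := hA.complete N u u' e₀ hu (hA.elected_of_entryAt he) hp hc.choosable
    have h2 := entryAt_le_length hp.1
    rwa [entryAt_prefix h1 (by rw [List.length_take]; omega), entryAt_take hi] at he
  obtain ⟨N, u, e₀, h1, h2, h3, h4⟩ := h
  obtain ⟨N', u', e₀', h1', h2', h3', h4'⟩ := h'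
  rcases lt_trichotomy u u' with hu | rfl | hu
  · exact Option.some.inj (h4.symm.trans (key N u e₀ e' u' h1 h2 h3 hu h4'))
  · exact Option.some.inj (h4.symm.trans h4')
  · exact Option.some.inj ((key N' u' e₀' e u h1' h2' h3' hu h4).symm.trans h4')

/-! ### Raft: votes -/

/-- The history of votes: whom each server voted for in each term. -/
abbrev Votes (n : ℕ) := Fin n → ℕ → Option (Fin n)

/-- Server `s` has the votes of a majority in term `t`. -/
def Won (V : Votes n) (s : Fin n) (t : ℕ) : Prop :=
  ∃ Q : Finset (Fin n), IsMajority Q ∧ ∀ j ∈ Q, V j t = some s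

def VotesLe (V V' : Votes n) : Prop :=
  ∀ j t r, V j t = some r → V' j t = some r

theorem Won.mono {V V' : Votes n} (hV : VotesLe V V') {s : Fin n} {t : ℕ} (h : Won V s t) :
    Won V' s t :=
  let ⟨Q, hQ, h⟩ := h
  ⟨Q, hQ, fun j hj => hV j t s (h j hj)⟩

theorem Won.unique {V : Votes n} {s r : Fin n} {t : ℕ} (h : Won V s t) (h' : Won V r t) :
    s = r := by
  obtain ⟨Q, hQ, h⟩ := h
  obtain ⟨R, hR, h'⟩ := h'
  obtain ⟨j, hj, hj'⟩ := hQ.exists_common hR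
  exact Option.some.inj ((h j hj).symm.trans (h' j hj'))

/-- Server `s` votes for server `r` in term `t`. -/
def castVote (V : Votes n) (s : Fin n) (t : ℕ) (r : Fin n) : Votes n :=
  Function.update V s (Function.update (V s) t (some r))

theorem castVote_self (V : Votes n) (s : Fin n) (t : ℕ) (r : Fin n) :
    castVote V s t r s t = some r := by
  simp [castVote]

theorem castVote_ne (V : Votes n) (s : Fin n) {t u : ℕ} (r : Fin n) (h : u ≠ t) :
    castVote V s t r s u = V s u := by
  simp [castVote, h]

theorem votesLe_castVote {V : Votes n} {s : Fin n} {t : ℕ} {r : Fin n}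
    (h : V s t = none ∨ V s t = some r) : VotesLe V (castVote V s t r) := by
  intro j u q hq
  by_cases hj : j = s
  · subst hj
    by_cases hu : u = t
    · subst hu
      rw [castVote_self]
      rcases h with h | h
      · rw [h] at hq; cases hq
      · rw [← hq, h]
    · rwa [castVote_ne _ _ _ hu]
  · simpa [castVote, hj] using hq

/-! ### Raft: servers and messages -/

/-- Terms do not belong to servers in advance, so `owner` speaks of the winner of the votes. Its
second part prevents a server from being elected twice in one term, also after a crash. The clause
`not_voted` makes it legitimate to reset `votedFor` on entering a later term. -/
structure ServerOk (A : View n Op) (V : Votes n) (s : Fin n) (x : Server n Op) : Prop where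
  vote : V s x.currentTerm = x.votedFor
  not_voted : ∀ t, x.currentTerm < t → V s t = none
  owner : ∀ t ∈ A.elected, Won V s t →
    t ≤ x.currentTerm ∧ (x.currentTerm = t → x.role ≠ .candidate)
  commit : Committed A x.currentTerm x.log x.commitIndex
  leader : x.role = .leader → Won V s x.currentTerm ∧ x.currentTerm ∈ A.elected ∧
    A.leaderLog x.currentTerm = x.log ∧ x.log.length ≤ A.acked s x.currentTerm ∧
    ∀ j, x.matchIndex j ≤ A.acked j x.currentTerm ∧ 1 ≤ x.nextIndex j ∧
      x.nextIndex j ≤ x.log.length + 1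
  candidate : x.role = .candidate → ∀ j ∈ x.votes, V j x.currentTerm = some s ∧
    x.currentTerm ≤ A.term j ∧
    Fresh A j x.currentTerm x.log.length (termAt x.log x.log.length)

/-- Server `x` asked for votes in term `t` with last log index `li` and last log term `lt`. -/
def RequestOk (x : Server n Op) (t li lt : ℕ) : Prop :=
  t ≤ x.currentTerm ∧ (x.role = .candidate → x.currentTerm = t →
    x.log.length = li ∧ termAt x.log x.log.length = lt)

/-- A vote does not carry the log position that it was granted for, hence the existential.
`RequestOk` identifies this position with the candidate's present one. -/
def MessageOk (A : View n Op) (V : Votes n) (srv : Fin n → Server n Op)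
    (m : Message n (Payload Op)) : Prop :=
  match m.payload with
  | .requestVote t li lt => RequestOk (srv m.src) t li lt
  | .voteReply t _ granted => granted = true →
      V m.src t = some m.dst ∧ t ≤ A.term m.src ∧
      ∃ li lt, RequestOk (srv m.dst) t li lt ∧ Fresh A m.src t li lt
  | .appendEntries a => A.AppendOk a ∧ Committed A a.term (A.leaderLog a.term) a.leaderCommit
  | .appendReply a _ success => success = true → a.lastIndex ≤ A.acked m.src a.term

/-- What the history says about a single server. -/
structure Local (A : View n Op) (V : Votes n) (s : Fin n) (x : Server n Op) : Prop where
  inv : LogInv A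
  won : ∀ t ∈ A.elected, ∃ r, Won V r t
  term_eq : A.term s = x.currentTerm
  log_eq : A.log s = x.log
  ok : ServerOk A V s x

/-- A step of server `s` with its states and histories before and after. -/
structure Trans (A : View n Op) (V : Votes n) (s : Fin n) (x : Server n Op) (A' : View n Op)
    (V' : Votes n) (x' : Server n Op) : Prop where
  le : A.Le A'
  votes_le : VotesLe V V'
  term_ne : ∀ j, j ≠ s → A'.term j = A.term j
  log_ne : ∀ j, j ≠ s → A'.log j = A.log j
  votes_ne : ∀ j, j ≠ s → V' j = V j
  frame : ∀ t, (A'.leaderLog t = A.leaderLog t ∧ (t ∈ A'.elected → t ∈ A.elected)) ∨ Won V' s t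
  loc : Local A' V' s x'
  term_le : x.currentTerm ≤ x'.currentTerm
  candidate : x'.role = .candidate → x'.currentTerm = x.currentTerm →
    x.role = .candidate ∧ x'.log = x.log

theorem Trans.trans {A B C : View n Op} {V V' V'' : Votes n} {s : Fin n} {x y z : Server n Op}
    (h : Trans A V s x B V' y) (h' : Trans B V' s y C V'' z) : Trans A V s x C V'' z where
  le := h.le.trans h'.le
  votes_le j t r hr := h'.votes_le j t r (h.votes_le j t r hr)
  term_ne j hj := (h'.term_ne j hj).trans (h.term_ne j hj)
  log_ne j hj := (h'.log_ne j hj).trans (h.log_ne j hj)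
  votes_ne j hj := (h'.votes_ne j hj).trans (h.votes_ne j hj)
  frame t := by
    rcases h.frame t with h1 | h1
    · rcases h'.frame t with h2 | h2
      · exact .inl ⟨h2.1.trans h1.1, fun ht => h1.2 (h2.2 ht)⟩
      · exact .inr h2
    · exact .inr (h1.mono h'.votes_le)
  loc := h'.loc
  term_le := h.term_le.trans h'.term_le
  candidate hz ht := by
    have h1 := h.term_le
    have h2 := h'.term_le
    obtain ⟨h3, h4⟩ := h'.candidate hz (by omega)
    obtain ⟨h5, h6⟩ := h.candidate h3 (by omega)
    exact ⟨h5, h4.trans h6⟩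

/-- A step that leaves the history as it is. -/
theorem Local.trans_self {A : View n Op} {V : Votes n} {s : Fin n} {x x' : Server n Op}
    (h : Local A V s x) (ht : x'.currentTerm = x.currentTerm) (hl : x'.log = x.log)
    (hok : ServerOk A V s x') (hc : x'.role = .candidate → x.role = .candidate) :
    Trans A V s x A V x' :=
  ⟨.rfl, fun _ _ _ => id, fun _ _ => rfl, fun _ _ => rfl, fun _ _ => rfl,
    fun _ => .inl ⟨rfl, id⟩, ⟨h.inv, h.won, h.term_eq.trans ht.symm, h.log_eq.trans hl.symm, hok⟩,
    ht.ge, fun h _ => ⟨hc h, hl⟩⟩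

theorem Local.trans_rfl {A : View n Op} {V : Votes n} {s : Fin n} {x : Server n Op}
    (h : Local A V s x) : Trans A V s x A V x :=
  h.trans_self rfl rfl h.ok id

/-- Votes cast after an election do not change its winner. -/
theorem Local.won_of_votesLe {A : View n Op} {V V' : Votes n} {s r : Fin n} {x : Server n Op}
    (h : Local A V s x) (hV : VotesLe V V') {t : ℕ} (ht : t ∈ A.elected) (hw : Won V' r t) :
    Won V r t := by
  obtain ⟨q, hq⟩ := h.won t ht
  rwa [hw.unique (hq.mono hV)]

/-- A server enters a later term. -/
theorem Local.trans_bump {A : View n Op} {V V' : Votes n} {s : Fin n} {x x' : Server n Op}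
    (h : Local A V s x) (ht : x.currentTerm < x'.currentTerm) (hl : x'.log = x.log)
    (hV : VotesLe V V') (hVne : ∀ j, j ≠ s → V' j = V j)
    (hok : ServerOk (A.bump s x'.currentTerm) V' s x') :
    Trans A V s x (A.bump s x'.currentTerm) V' x' where
  le := A.le_bump (h.term_eq.trans_le ht.le)
  votes_le := hV
  term_ne j hj := by simp [View.bump, hj]
  log_ne _ _ := rfl
  votes_ne := hVne
  frame _ := .inl ⟨rfl, id⟩
  loc := ⟨h.inv.bump (h.term_eq.trans_le ht.le), fun t ht => (h.won t ht).imp fun _ h => h.mono hV,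
    by simp [View.bump], h.log_eq.trans hl.symm, hok⟩
  term_le := ht.le
  candidate _ h := by omega

theorem Local.observe {A : View n Op} {V : Votes n} {s : Fin n} {x : Server n Op}
    (h : Local A V s x) (t : ℕ) : ∃ A', Trans A V s x A' V (x.observe t) := by
  unfold Server.observe
  split_ifs with ht
  · have hle := A.le_bump (h.term_eq.trans_le ht.le)
    refine ⟨_, h.trans_bump
      (x' := { x with currentTerm := t, votedFor := none, role := .follower }) ht rfl
      (fun _ _ _ => id) (fun _ _ => rfl) ⟨h.ok.not_voted t ht, fun u hu => h.ok.not_voted u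
        (ht.trans hu), fun u hu hw => ⟨(h.ok.owner u hu hw).1.trans ht.le, nofun⟩,
        h.ok.commit.mono hle ht.le le_rfl List.prefix_rfl, nofun, nofun⟩⟩
  · exact ⟨A, h.trans_rfl⟩

theorem observe_currentTerm (x : Server n Op) (t : ℕ) :
    (x.observe t).currentTerm = max x.currentTerm t := by
  unfold Server.observe
  split_ifs <;> simp <;> omega

theorem RequestOk.trans {A A' : View n Op} {V V' : Votes n} {s : Fin n} {x x' : Server n Op}
    {t li lt : ℕ} (h : RequestOk x t li lt) (hT : Trans A V s x A' V' x') :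
    RequestOk x' t li lt := by
  refine ⟨h.1.trans hT.term_le, fun hc ht => ?_⟩
  have h1 := h.1
  have h2 := hT.term_le
  obtain ⟨h3, h4⟩ := hT.candidate hc (by omega)
  rw [h4]
  exact h.2 h3 (by omega)

theorem RequestOk.update {A A' : View n Op} {V V' : Votes n} {s : Fin n}
    {srv : Fin n → Server n Op} {x' : Server n Op} {t li lt : ℕ} {j : Fin n}
    (h : RequestOk (srv j) t li lt) (hT : Trans A V s (srv s) A' V' x') :
    RequestOk (Function.update srv s x' j) t li lt := by
  by_cases hj : j = s
  · subst hj
    rw [Function.update_self]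
    exact h.trans hT
  · rwa [Function.update_of_ne hj]

theorem MessageOk.trans {A A' : View n Op} {V V' : Votes n} {s : Fin n}
    {srv : Fin n → Server n Op} {x' : Server n Op} {m : Message n (Payload Op)} (hB : A.Base)
    (h : MessageOk A V srv m) (hT : Trans A V s (srv s) A' V' x') :
    MessageOk A' V' (Function.update srv s x') m := by
  unfold MessageOk at h ⊢
  split <;> rename_i heq <;> simp only [heq] at h
  · exact h.update hT
  · intro hg
    obtain ⟨h1, h2, li, lt, h3, h4⟩ := h hg
    exact ⟨hT.votes_le _ _ _ h1, h2.trans (hT.le.term _), li, lt, h3.update hT,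
      h4.mono hB hT.le h2⟩
  · exact ⟨h.1.mono hT.le, h.2.mono hT.le le_rfl le_rfl (hT.le.leaderLog _)⟩
  · exact fun hs => (h hs).trans (hT.le.acked _ _)

/-- A term has at most one winner, so a step of `s` cannot change the leader log of a term won by
`j`. -/
theorem Local.trans_ne {A A' : View n Op} {V V' : Votes n} {s j : Fin n} {x x' y : Server n Op}
    (h : Local A V j y) (hT : Trans A V s x A' V' x') (hj : j ≠ s) : Local A' V' j y := by
  have hframe : ∀ t, Won V' j t →
      A'.leaderLog t = A.leaderLog t ∧ (t ∈ A'.elected → t ∈ A.elected) := fun t ht =>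
    (hT.frame t).resolve_right fun hs => hj (ht.unique hs)
  have hB := h.inv.toBase
  refine ⟨hT.loc.inv, hT.loc.won, (hT.term_ne j hj).trans h.term_eq,
    (hT.log_ne j hj).trans h.log_eq, ⟨by rw [hT.votes_ne j hj]; exact h.ok.vote,
      fun t ht => by rw [hT.votes_ne j hj]; exact h.ok.not_voted t ht, fun t ht hw => ?_,
      h.ok.commit.mono hT.le le_rfl le_rfl List.prefix_rfl, fun hr => ?_, fun hr k hk => ?_⟩⟩
  · have ht' := (hframe t hw).2 ht
    exact h.ok.owner t ht' (h.won_of_votesLe hT.votes_le ht' hw)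
  · obtain ⟨h1, h2, h3, h4, h5⟩ := h.ok.leader hr
    have h1' := h1.mono hT.votes_le
    exact ⟨h1', hT.le.elected h2, (hframe _ h1').1.trans h3, h4.trans (hT.le.acked _ _), fun k =>
      ⟨(h5 k).1.trans (hT.le.acked _ _), (h5 k).2⟩⟩
  · obtain ⟨h1, h2, h3⟩ := h.ok.candidate hr k hk
    exact ⟨hT.votes_le _ _ _ h1, h2.trans (hT.le.term _), h3.mono hB hT.le h2⟩

/-- The invariant of all executions; `h` lists the applications so far. -/
structure Inv (A : View n Op) (V : Votes n) (h : List (Applied n Op))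
    (σ : Global n (Server n Op) (Payload Op)) : Prop where
  loc : ∀ s, Local A V s (σ.server s)
  messages : ∀ m ∈ σ.net, MessageOk A V σ.server m
  applied : ∀ a ∈ h, Final A a.index a.entry

theorem Inv.step {A A' : View n Op} {V V' : Votes n} {h : List (Applied n Op)}
    {σ : Global n (Server n Op) (Payload Op)} (hI : Inv A V h σ) {s : Fin n} {x' : Server n Op}
    {out : Set (Message n (Payload Op))} {ev : Option (Applied n Op)}
    (hT : Trans A V s (σ.server s) A' V' x')
    (hout : ∀ m ∈ out, MessageOk A' V' (Function.update σ.server s x') m)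
    (hev : ∀ a ∈ ev, Final A' a.index a.entry) :
    Inv A' V' (h ++ ev.toList) ⟨Function.update σ.server s x', σ.net ∪ out⟩ := by
  refine ⟨fun j => ?_, fun m hm => ?_, fun a ha => ?_⟩
  · by_cases hj : j = s
    · subst hj
      simpa using hT.loc
    · simp only [Function.update_of_ne hj]
      exact (hI.loc j).trans_ne hT hj
  · rcases hm with hm | hm
    · exact (hI.messages m hm).trans (hI.loc s).inv.toBase hT
    · exact hout m hm
  · rcases List.mem_append.1 ha with ha | ha
    · exact (hI.applied a ha).mono hT.le
    · exact hev a (by simpa using ha)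

/-! ### Raft: the steps of a single server -/

theorem Local.act {A : View n Op} {V : Votes n} {s : Fin n} {srv : Fin n → Server n Op}
    {ev : Option (ℕ × Entry Op)} {x' : Server n Op} {out : Set (Message n (Payload Op))}
    (hL : Local A V s (srv s)) (hact : Act s (srv s) ev x' out) :
    ∃ A' V', Trans A V s (srv s) A' V' x' ∧
      (∀ m ∈ out, MessageOk A' V' (Function.update srv s x') m) ∧
      ∀ p ∈ ev, Final A' p.1 p.2 := by
  generalize hx : srv s = x at hL hact ⊢
  induction hact with
  | restart =>
    exact ⟨A, V, hL.trans_self rfl rfl ⟨hL.ok.vote, hL.ok.not_voted, fun t ht hw =>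
      ⟨(hL.ok.owner t ht hw).1, nofun⟩, .inl rfl, nofun, nofun⟩ nofun, nofun, nofun⟩
  | timeout hrole =>
    have hlt : x.currentTerm < x.currentTerm + 1 := Nat.lt_succ_self _
    have hV : VotesLe V (castVote V s (x.currentTerm + 1) s) :=
      votesLe_castVote (.inl (hL.ok.not_voted _ hlt))
    have hts := hL.term_eq.trans_le hlt.le
    refine ⟨_, _, hL.trans_bump (x' := { x with
      currentTerm := x.currentTerm + 1
      votedFor := some s
      role := .candidate
      votes := {s} }) hlt rfl hV (fun j hj => by simp [castVote, hj])
        ⟨castVote_self _ _ _ _, fun t ht => ?_, fun t ht hw => ?_,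
          hL.ok.commit.mono (A.le_bump hts) hlt.le le_rfl List.prefix_rfl, nofun,
          fun _ j hj => ?_⟩, ?_, nofun⟩
    · rw [castVote_ne _ _ _ ht.ne']
      exact hL.ok.not_voted t (hlt.trans ht)
    · have := (hL.ok.owner t ht (hL.won_of_votesLe hV ht hw)).1
      dsimp only
      exact ⟨by omega, by omega⟩
    · obtain rfl : j = s := by simpa using hj
      refine ⟨castVote_self _ _ _ _, by simp [View.bump], (hL.inv.bump hts).fresh ?_⟩
      rw [show (A.bump j (x.currentTerm + 1)).log j = x.log from hL.log_eq]
      exact .inr ⟨rfl, le_rfl⟩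
    · rintro m ⟨j, -, rfl⟩
      simp [MessageOk, RequestOk]
  | becomeLeader hrole hvotes =>
    have hc := hL.ok.candidate hrole
    have hwon : Won V s x.currentTerm := ⟨_, hvotes, fun j hj => (hc j hj).1⟩
    -- Were the term already elected, its winner would be `s` itself, which `owner` then forbids to
    -- be a candidate.
    have hel : x.currentTerm ∉ A.elected := fun h => (hL.ok.owner _ h hwon).2 rfl hrole
    have hnil : A.leaderLog x.currentTerm <+: A.log s := by
      rw [hL.inv.leaderLog_eq_nil _ hel]; exact List.nil_prefix
    have hle := View.le_lead hL.inv.toBase hL.term_eq hnil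
    have hinv := hL.inv.elect hL.term_eq hel hvotes fun j hj => by
      rw [hL.log_eq]; exact (hc j hj).2
    rw [hL.log_eq] at hle hinv
    refine ⟨A.lead s x.currentTerm x.log, V, ⟨hle, fun _ _ _ => id, fun _ _ => rfl, fun j hj => by
      simp [View.lead, hj], fun _ _ => rfl, fun t => ?_, ⟨hinv, fun t ht => ?_, hL.term_eq,
        by simp [View.lead], ⟨hL.ok.vote, hL.ok.not_voted, fun t ht hw => ⟨?_, nofun⟩,
          hL.ok.commit.mono hle le_rfl le_rfl List.prefix_rfl, fun _ => ⟨hwon, .inl rfl,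
            by simp [View.lead], by simp [View.lead], fun j => by simp⟩, nofun⟩⟩, le_rfl, nofun⟩,
        nofun, nofun⟩
    · by_cases ht : t = x.currentTerm
      · exact .inr (ht ▸ hwon)
      · exact .inl (by simp [View.lead, ht])
    · rcases ht with rfl | ht
      exacts [⟨s, hwon⟩, hL.won t ht]
    · rcases ht with rfl | ht
      exacts [le_rfl, (hL.ok.owner t ht hw).1]
  | clientRequest op hrole =>
    obtain ⟨h1, h2, h3, hself, h4⟩ := hL.ok.leader hrole
    have hpre := List.prefix_append (A.leaderLog x.currentTerm) [⟨op, x.currentTerm⟩]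
    have hle := View.le_lead hL.inv.toBase hL.term_eq hpre
    have hinv := hL.inv.concat (a := ⟨op, x.currentTerm⟩) hL.term_eq h2
      (hL.log_eq.trans h3.symm) rfl
    rw [h3] at hle hinv hpre
    have hr : x.role ≠ .candidate := by rw [hrole]; nofun
    refine ⟨A.lead s x.currentTerm (x.log ++ [⟨op, x.currentTerm⟩]), V, ⟨hle, fun _ _ _ => id,
      fun _ _ => rfl, fun j hj => by simp [View.lead, hj], fun _ _ => rfl, fun t => ?_, ⟨hinv,
        fun t ht => ?_, hL.term_eq, by simp [View.lead], ⟨hL.ok.vote, hL.ok.not_voted,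
          fun t ht hw => ⟨?_, fun _ => hr⟩, hL.ok.commit.mono hle le_rfl le_rfl hpre,
          fun _ => ⟨h1, .inl rfl, by simp [View.lead], by simp [View.lead], fun j => ?_⟩,
          fun h => absurd h hr⟩⟩, le_rfl, fun h => absurd h hr⟩, nofun, nofun⟩
    · by_cases ht : t = x.currentTerm
      · exact .inr (ht ▸ h1)
      · exact .inl (by simp [View.lead, ht])
    · rcases ht with rfl | ht
      exacts [⟨s, h1⟩, hL.won t ht]
    · rcases ht with rfl | ht
      exacts [le_rfl, (hL.ok.owner t ht hw).1]
    · obtain ⟨h5, h6, h7⟩ := h4 j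
      refine ⟨h5.trans (hle.acked _ _), h6, ?_⟩
      simp only [List.length_append]
      omega
  | replicate j k hj hrole =>
    refine ⟨A, V, hL.trans_rfl, ?_, nofun⟩
    rintro m rfl
    obtain ⟨-, h2, h3, -, h4⟩ := hL.ok.leader hrole
    obtain ⟨-, h5, h6⟩ := h4 j
    refine ⟨View.appendOk_of_leader (k := x.nextIndex j) h2 h5 ?_ rfl ?_ ?_, ?_⟩ <;>
      simp only [Server.appendArgs, h3]
    · exact h6
    · exact List.take_prefix _ _
    · exact hL.ok.commit
  | advanceCommit N e hrole hN he hterm hmaj =>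
    obtain ⟨h1, h2, h3, hself, h4⟩ := hL.ok.leader hrole
    have hr : x.role ≠ .candidate := by rw [hrole]; nofun
    -- Here the restriction to entries of the current term matters: it makes the entry at `N` a
    -- proposal of this term, to which completeness of later leaders applies.
    refine ⟨A, V, hL.trans_self rfl rfl ⟨hL.ok.vote, hL.ok.not_voted, hL.ok.owner, .inr ⟨N,
      x.currentTerm, e, le_rfl, le_rfl, ⟨by rwa [h3], hterm⟩, ⟨_, hmaj, fun j hj => ?_⟩, ?_⟩,
      hL.ok.leader, fun h => absurd h hr⟩ fun h => absurd h hr, nofun, nofun⟩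
    · rcases (Finset.mem_filter.1 hj).2 with rfl | hj
      · exact (entryAt_le_length he).trans hself
      · exact hj.trans (h4 j).1
    · rw [h3]
      exact List.take_prefix _ _
  | apply e hlt he =>
    refine ⟨A, V, hL.trans_self rfl rfl ⟨hL.ok.vote, hL.ok.not_voted, hL.ok.owner, hL.ok.commit,
      hL.ok.leader, hL.ok.candidate⟩ id, nofun, ?_⟩
    rintro _ ⟨⟩
    exact hL.ok.commit.final hlt he

theorem Local.receive_requestVote {A : View n Op} {V : Votes n} {s : Fin n}
    {srv : Fin n → Server n Op} (hL : Local A V s (srv s)) {m : Message n (Payload Op)}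
    {t li lt : ℕ} (hp : m.payload = .requestVote t li lt) (hm : MessageOk A V srv m) :
    ∃ A' V', Trans A V s (srv s) A' V' (receive s (srv s) m).1 ∧
      ∀ m' ∈ (receive s (srv s) m).2,
        MessageOk A' V' (Function.update srv s (receive s (srv s) m).1) m' := by
  simp only [MessageOk, hp] at hm
  simp only [receive, hp]
  split_ifs with hlt hv
  · refine ⟨A, V, hL.trans_rfl, ?_⟩
    rintro m' rfl
    exact nofun
  · obtain ⟨A', hT⟩ := hL.observe t
    have hterm : ((srv s).observe t).currentTerm = t := by
      rw [observe_currentTerm]; omega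
    have hL' := hT.loc
    generalize (srv s).observe t = y at hT hL' hterm hv ⊢
    subst hterm
    obtain ⟨hv, hup⟩ := hv
    rw [← hL'.ok.vote] at hv
    rw [← hL'.log_eq] at hup
    have hV := votesLe_castVote hv
    have hT' : Trans A V s (srv s) A' (castVote V s y.currentTerm m.src)
        { y with votedFor := some m.src } := by
      refine hT.trans ⟨.rfl, hV, fun _ _ => rfl, fun _ _ => rfl, fun j hj => by
        simp [castVote, hj], fun _ => .inl ⟨rfl, id⟩, ⟨hL'.inv, fun t ht =>
          (hL'.won t ht).imp fun _ h => h.mono hV, hL'.term_eq, hL'.log_eq,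
          ⟨castVote_self _ _ _ _, fun t ht => ?_, fun t ht hw =>
            hL'.ok.owner t ht (hL'.won_of_votesLe hV ht hw), hL'.ok.commit, fun hr => ?_,
            fun hr j hj => ?_⟩⟩, le_rfl, fun hr _ => ⟨hr, rfl⟩⟩
      · rw [castVote_ne _ _ _ (Nat.ne_of_gt ht)]
        exact hL'.ok.not_voted t ht
      · obtain ⟨h1, h2⟩ := hL'.ok.leader hr
        exact ⟨h1.mono hV, h2⟩
      · obtain ⟨h1, h2⟩ := hL'.ok.candidate hr j hj
        exact ⟨hV _ _ _ h1, h2⟩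
    refine ⟨_, _, hT', ?_⟩
    rintro m' rfl
    intro _
    exact ⟨castVote_self _ _ _ _, hL'.term_eq.ge, li, lt, hm.update hT', hL'.inv.fresh hup⟩
  · obtain ⟨A', hT⟩ := hL.observe t
    refine ⟨A', V, hT, ?_⟩
    rintro m' rfl
    exact nofun

theorem Local.receive_voteReply {A : View n Op} {V : Votes n} {s : Fin n}
    {srv : Fin n → Server n Op} (hL : Local A V s (srv s)) {m : Message n (Payload Op)}
    {r t : ℕ} {g : Bool} (hs : m.dst = s) (hp : m.payload = .voteReply r t g)
    (hm : MessageOk A V srv m) :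
    ∃ A' V', Trans A V s (srv s) A' V' (receive s (srv s) m).1 ∧
      ∀ m' ∈ (receive s (srv s) m).2,
        MessageOk A' V' (Function.update srv s (receive s (srv s) m).1) m' := by
  simp only [receive, hp]
  obtain ⟨A', hT⟩ := hL.observe t
  have hm' := hm.trans hL.inv.toBase hT
  simp only [MessageOk, hp, hs, Function.update_self] at hm'
  have hL' := hT.loc
  generalize (srv s).observe t = y at hT hL' hm' ⊢
  split_ifs with h
  · obtain ⟨hc, hr, -, hg⟩ := h
    obtain ⟨h1, h2, li, lt, h3, h4⟩ := hm' hg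
    -- The log position for which the vote was granted is still that of the candidate.
    obtain ⟨rfl, rfl⟩ := h3.2 hc hr.symm
    subst hr
    refine ⟨A', V, hT.trans (hL'.trans_self rfl rfl ⟨hL'.ok.vote, hL'.ok.not_voted, hL'.ok.owner,
      hL'.ok.commit, hL'.ok.leader, fun _ j hj => ?_⟩ id), nofun⟩
    rcases Finset.mem_insert.1 hj with rfl | hj
    · exact ⟨h1, h2, h4⟩
    · exact hL'.ok.candidate hc j hj
  · exact ⟨A', V, hT, nofun⟩

/-- Becoming a follower. -/
theorem Local.trans_follower {A : View n Op} {V : Votes n} {s : Fin n} {x : Server n Op}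
    (h : Local A V s x) : Trans A V s x A V { x with role := .follower } :=
  h.trans_self rfl rfl ⟨h.ok.vote, h.ok.not_voted, fun t ht hw =>
    ⟨(h.ok.owner t ht hw).1, nofun⟩, h.ok.commit, nofun, nofun⟩ nofun

theorem Local.receive_appendEntries {A : View n Op} {V : Votes n} {s : Fin n}
    {srv : Fin n → Server n Op} (hL : Local A V s (srv s)) {m : Message n (Payload Op)}
    {a : AppendArgs Op} (hp : m.payload = .appendEntries a) (hm : MessageOk A V srv m) :
    ∃ A' V', Trans A V s (srv s) A' V' (receive s (srv s) m).1 ∧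
      ∀ m' ∈ (receive s (srv s) m).2,
        MessageOk A' V' (Function.update srv s (receive s (srv s) m).1) m' := by
  simp only [receive, hp]
  split_ifs with hlt hmatch
  · refine ⟨A, V, hL.trans_rfl, ?_⟩
    rintro m' rfl
    exact nofun
  · obtain ⟨A', hT⟩ := hL.observe a.term
    have hm' := hm.trans hL.inv.toBase hT
    have hterm : ((srv s).observe a.term).currentTerm = a.term := by
      rw [observe_currentTerm]; omega
    simp only [MessageOk, hp] at hm'
    replace hT := hT.trans hT.loc.trans_follower
    have hL' := hT.loc
    generalize (srv s).observe a.term = y at hT hL' hterm hmatch ⊢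
    obtain ⟨⟨hel, p, hlen, hpre, hv⟩, hcommit⟩ := hm'
    have hlast : a.lastIndex = (p ++ a.entries).length := by
      rw [List.length_append, hlen]; rfl
    rw [← hlen] at hmatch
    have hlog : A'.log s = y.log := hL'.log_eq
    have hgen : A'.Genuine y.log := hlog ▸ hL'.inv.genuine s
    have hstore := hgen.store_eq ((hL'.inv.genuine_leader _).of_prefix hpre) hmatch hv
    have hts : A'.term s ≤ a.term := (hL'.term_eq.trans hterm).le
    rw [hlen] at hstore
    have hle := A'.le_accept (p := p ++ a.entries) hts
    refine ⟨A'.accept s a.term (p ++ a.entries), V, hT.trans ⟨hle, fun _ _ _ => id, fun j hj => by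
      simp [View.accept, hj], fun j hj => by simp [View.accept, hj], fun _ _ => rfl,
      fun _ => .inl ⟨rfl, id⟩, ⟨hL'.inv.accept hts hel hpre, hL'.won,
        by simp [View.accept, hterm], by simp [View.accept, hstore, hlog], ⟨hL'.ok.vote,
          hL'.ok.not_voted, hL'.ok.owner, ?_, nofun, nofun⟩⟩, le_rfl, nofun⟩, ?_⟩
    · suffices h : Committed A' a.term (merge y.log (p ++ a.entries))
          (max y.commitIndex (min a.leaderCommit a.lastIndex)) by
        dsimp only
        rw [hstore, hterm]
        exact h.mono hle le_rfl le_rfl List.prefix_rfl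
      -- Either the old commit index stands, and its segment survives the storage, or the leader's
      -- does, cut down to what the request covers.
      rcases max_choice y.commitIndex (min a.leaderCommit a.lastIndex) with h | h <;> rw [h]
      · exact hL'.inv.committed_merge hL'.ok.commit hterm.le hel hpre
      · refine Committed.mono .rfl ?_ le_rfl le_rfl (prefix_merge _ _)
        exact (hcommit.mono .rfl le_rfl (min_le_left _ _) List.prefix_rfl).prefix_of_le hpre
          ((min_le_right _ _).trans hlast.le)
    · rintro m' rfl
      intro _
      simp [View.accept, hlast]
  · obtain ⟨A', hT⟩ := hL.observe a.term
    refine ⟨A', V, hT.trans hT.loc.trans_follower, ?_⟩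
    rintro m' rfl
    exact nofun

theorem Local.receive_appendReply {A : View n Op} {V : Votes n} {s : Fin n}
    {srv : Fin n → Server n Op} (hL : Local A V s (srv s)) {m : Message n (Payload Op)}
    {a : AppendArgs Op} {t : ℕ} {b : Bool} (hp : m.payload = .appendReply a t b)
    (hm : MessageOk A V srv m) :
    ∃ A' V', Trans A V s (srv s) A' V' (receive s (srv s) m).1 ∧
      ∀ m' ∈ (receive s (srv s) m).2,
        MessageOk A' V' (Function.update srv s (receive s (srv s) m).1) m' := by
  simp only [receive, hp]
  obtain ⟨A', hT⟩ := hL.observe t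
  have hm' := hm.trans hL.inv.toBase hT
  simp only [MessageOk, hp] at hm'
  have hL' := hT.loc
  generalize (srv s).observe t = y at hT hL' hm' ⊢
  split_ifs with h hb
  · obtain ⟨hr, ha, -⟩ := h
    obtain ⟨h1, h2, h3, h4, h5⟩ := hL'.ok.leader hr
    have h6 := hm' hb
    rw [ha] at h6
    have h7 := hL'.inv.acked_le m.src y.currentTerm
    rw [h3] at h7
    refine ⟨A', V, hT.trans (hL'.trans_self rfl rfl ⟨hL'.ok.vote, hL'.ok.not_voted, hL'.ok.owner,
      hL'.ok.commit, fun _ => ⟨h1, h2, h3, h4, fun j => ?_⟩, hL'.ok.candidate⟩ id), nofun⟩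
    by_cases hj : j = m.src
    · subst hj
      have h8 := (h5 m.src).1
      simp only [Function.update_self]
      omega
    · simpa [hj] using h5 j
  · obtain ⟨hr, ha, -⟩ := h
    obtain ⟨h1, h2, h3, h4, h5⟩ := hL'.ok.leader hr
    refine ⟨A', V, hT.trans (hL'.trans_self rfl rfl ⟨hL'.ok.vote, hL'.ok.not_voted, hL'.ok.owner,
      hL'.ok.commit, fun _ => ⟨h1, h2, h3, h4, fun j => ?_⟩, hL'.ok.candidate⟩ id), nofun⟩
    by_cases hj : j = m.src
    · subst hj
      have h8 := h5 m.src
      simp only [Function.update_self]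
      omega
    · simpa [hj] using h5 j
  · exact ⟨A', V, hT, nofun⟩

theorem Local.receive {A : View n Op} {V : Votes n} {s : Fin n} {srv : Fin n → Server n Op}
    (hL : Local A V s (srv s)) {m : Message n (Payload Op)} (hs : m.dst = s)
    (hm : MessageOk A V srv m) :
    ∃ A' V', Trans A V s (srv s) A' V' (receive s (srv s) m).1 ∧
      ∀ m' ∈ (Raft.receive s (srv s) m).2,
        MessageOk A' V' (Function.update srv s (Raft.receive s (srv s) m).1) m' := by
  cases hp : m.payload with
  | requestVote t li lt => exact hL.receive_requestVote hp hm
  | voteReply r t g => exact hL.receive_voteReply hs hp hm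
  | appendEntries a => exact hL.receive_appendEntries hp hm
  | appendReply a t b => exact hL.receive_appendReply hp hm

/-! ### Raft: executions -/

theorem exists_inv_init :
    ∃ (A : View n Op) (V : Votes n), Inv A V [] ⟨fun _ => boot 0 none [], ∅⟩ := by
  refine ⟨⟨fun _ => 0, fun _ => [], fun _ => [], ∅, fun _ _ => 0⟩, fun _ _ => none,
    fun s => ⟨⟨⟨?_, ?_, ?_, ?_, ?_, ?_, ?_, ?_⟩, ?_, ?_, ?_⟩, ?_, rfl, rfl,
      ⟨rfl, fun _ _ => rfl, ?_, .inl rfl, nofun, nofun⟩⟩, nofun, nofun⟩ <;>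
    simp [View.Genuine, View.Proposal, entryAt]

theorem exists_inv {h : List (Applied n Op)} {σ : Global n (Server n Op) (Payload Op)}
    (hrun : Run (protocol n Op) h σ) : ∃ A V, Inv A V h σ := by
  induction hrun with
  | init => exact exists_inv_init
  | step h σ ev σ' _ hstep ih =>
    obtain ⟨A, V, hI⟩ := ih
    cases hstep with
    | act s ev x' out hact =>
      obtain ⟨A', V', hT, hout, hev⟩ := (hI.loc s).act hact
      refine ⟨A', V', hI.step hT hout fun a ha => ?_⟩
      obtain ⟨p, hp, rfl⟩ := Option.map_eq_some_iff.1 ha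
      exact hev p hp
    | deliver m hm =>
      obtain ⟨A', V', hT, hout⟩ := (hI.loc m.dst).receive rfl (hI.messages m hm)
      exact ⟨A', V', hI.step (ev := none) hT hout nofun⟩

/-- State machine safety for Raft. -/
theorem eq_of_applied {h : List (Applied n Op)} {σ : Global n (Server n Op) (Payload Op)}
    (hrun : Run (protocol n Op) h σ) {s s' : Fin n} {i : ℕ} {e e' : Entry Op}
    (he : ⟨s, i, e⟩ ∈ h) (he' : ⟨s', i, e'⟩ ∈ h) : e = e' := by
  obtain ⟨A, V, hI⟩ := exists_inv hrun
  exact (hI.loc s).inv.eq_of_final (hI.applied _ he) (hI.applied _ he')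

end Consensus.Raft

theorem mainTheorem2 (n : ℕ) (Op : Type*) :
    (∀ (h : List (Consensus.Applied n Op))
        (σ : Consensus.Global n (Consensus.Paxos.Server n Op) (Consensus.Paxos.Payload Op)),
        Consensus.Run (Consensus.Paxos.protocol n Op) h σ →
        ∀ (s s' : Fin n) (i : ℕ) (e e' : Consensus.Entry Op),
          ⟨s, i, e⟩ ∈ h → ⟨s', i, e'⟩ ∈ h → e.op = e'.op) ∧
    (∀ (h : List (Consensus.Applied n Op))
        (σ : Consensus.Global n (Consensus.Raft.Server n Op) (Consensus.Raft.Payload Op)),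
        Consensus.Run (Consensus.Raft.protocol n Op) h σ →
        ∀ (s s' : Fin n) (i : ℕ) (e e' : Consensus.Entry Op),
          ⟨s, i, e⟩ ∈ h → ⟨s', i, e'⟩ ∈ h → e = e') :=
  ⟨fun _ _ hrun _ _ _ _ _ he he' => Consensus.Paxos.op_eq_of_applied hrun he he',
    fun _ _ hrun _ _ _ _ _ he he' => Consensus.Raft.eq_of_applied hrun he he'⟩
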